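/- All manifolds are smooth, finite-dimensional, Hausdorff, paracompact and without boundary. Let $G$ be a connected, non-simply-connected Lie group, and let $\rho:\tilde G\to G$ be its universal covering group, i.e. $\tilde G$ is a simply connected Lie group and $\rho$ is a homomorphism which is a smooth covering map. Let $\pi_P:P\to M$ be a smooth (right) principal $G$-bundle over a connected manifold $M$, and fix $p_0\in P$. Write $\pi_1(P)=\pi_1(P,p_0)$, $\pi_1(M)=\pi_1(M,\pi_P(p_0))$, $\pi_1(G)=\pi_1(G,e)$, let $\pi_{P*}:\pi_1(P)\to\pi_1(M)$ be the homomorphism induced by $\pi_P$, and let $i_*:\pi_1(G)\to\pi_1(P)$ be the homomorphism induced by $i:G\to P$, $i(g)=p_0g$. A spinor structure for $P$ is a smooth principal $\tilde G$-bundle $\pi_Q:Q\to M$ together with a smooth map $u:Q\to P$ such that $\pi_P\circ u=\pi_Q$ and $u(q\tilde g)=u(q)\rho(\tilde g)$ for all $q\in Q$, $\tilde g\in\tilde G$. Then $P$ has a spinor structure if and only if there are subgroups $K$ and $I$ of $\pi_1(P)$ such that $\pi_1(P)$ is the internal direct product $K\times I$ (the elements of $K$ commute with those of $I$, $K\cap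 I$ is trivial, and $K$ and $I$ together generate $\pi_1(P)$), $\pi_{P*}$ maps $K$ isomorphically onto $\pi_1(M)$, and $i_*$ maps $\pi_1(G)$ isomorphically onto $I$. -/

import Mathlib

open scoped Manifold ContDiff

universe uM uG uGt uP

/-- A smooth principal fibre bundle `π : P → M` with structure group `G`, where `M`, `G`, `P` are
smooth manifolds of dimension `n`, `k`, `d`. The right action `p g` of `G` on `P` is the action
`MulOpposite.op g • p` of the opposite group. -/
structure IsPrincipalBundle (n k d : ℕ)
    {M : Type uM} [TopologicalSpace M] [ChartedSpace (EuclideanSpace ℝ (Fin n)) M]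
    (G : Type uG) [Group G] [TopologicalSpace G] [ChartedSpace (EuclideanSpace ℝ (Fin k)) G]
    {P : Type uP} [TopologicalSpace P] [ChartedSpace (EuclideanSpace ℝ (Fin d)) P]
    [MulAction Gᵐᵒᵖ P] (π : P → M) : Prop where
  smooth_proj : ContMDiff (𝓡 d) (𝓡 n) ∞ π
  surjective_proj : Function.Surjective π
  smooth_action :
    ContMDiff ((𝓡 d).prod (𝓡 k)) (𝓡 d) ∞ (fun x : P × G => MulOpposite.op x.2 • x.1)
  proj_action : ∀ (p : P) (g : G), π (MulOpposite.op g • p) = π p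
  transitive : ∀ p p' : P, π p = π p' → ∃ g : G, MulOpposite.op g • p = p'
  free : ∀ (p : P) (g : G), MulOpposite.op g • p = p → g = 1
  /-- Around each point of the base there is a trivialisation `φ : U × G → π⁻¹(U)` (the inverse of
  `e` below), which is a diffeomorphism and satisfies `φ (m, g) = φ (m, 1) g`. -/
  locally_trivial : ∀ m₀ : M, ∃ e : Bundle.Trivialization G π, m₀ ∈ e.baseSet ∧
    ContMDiffOn (𝓡 d) ((𝓡 n).prod (𝓡 k)) ∞ e.toOpenPartialHomeomorph e.source ∧
    ContMDiffOn ((𝓡 n).prod (𝓡 k)) (𝓡 d) ∞ e.toOpenPartialHomeomorph.symm e.target ∧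
    ∀ m ∈ e.baseSet, ∀ g : G, e.toOpenPartialHomeomorph.symm (m, g) =
      MulOpposite.op g • e.toOpenPartialHomeomorph.symm (m, (1 : G))

/-- `ρ : G̃ → G` makes the Lie group `G̃` a universal covering group of the Lie group `G`:
`G̃` is simply connected and `ρ` is a homomorphism and a smooth covering map. -/
structure IsUniversalCoveringGroup (k : ℕ)
    {G : Type uG} [Group G] [TopologicalSpace G] [ChartedSpace (EuclideanSpace ℝ (Fin k)) G]
    {G' : Type uGt} [Group G'] [TopologicalSpace G'] [ChartedSpace (EuclideanSpace ℝ (Fin k)) G']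
    (ρ : G' →* G) : Prop where
  simplyConnected : SimplyConnectedSpace G'
  isCoveringMap : IsCoveringMap ρ
  isLocalDiffeomorph : IsLocalDiffeomorph (𝓡 k) (𝓡 k) ∞ ρ

/-- A spinor structure for the bundle `πP : P → M` relative to `ρ : G' → G`: a principal
`G'`-bundle `πQ : Q → M` together with a smooth map `u : Q → P` over the identity of `M` such that
`u (q g̃) = u q (ρ g̃)`. -/
structure SpinorStructure (n k d : ℕ)
    {M : Type uM} [TopologicalSpace M] [ChartedSpace (EuclideanSpace ℝ (Fin n)) M]
    {G : Type uG} [Group G]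
    {G' : Type uGt} [Group G'] [TopologicalSpace G'] [ChartedSpace (EuclideanSpace ℝ (Fin k)) G']
    (ρ : G' →* G)
    {P : Type uP} [TopologicalSpace P] [ChartedSpace (EuclideanSpace ℝ (Fin d)) P]
    [MulAction Gᵐᵒᵖ P] (πP : P → M) where
  /-- The total space, a smooth manifold of dimension `dim`. -/
  Q : Type uP
  dim : ℕ
  [topologicalSpace : TopologicalSpace Q]
  [chartedSpace : ChartedSpace (EuclideanSpace ℝ (Fin dim)) Q]
  [isManifold : IsManifold (𝓡 dim) ∞ Q]
  [t2Space : T2Space Q]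
  [paracompactSpace : ParacompactSpace Q]
  [mulAction : MulAction G'ᵐᵒᵖ Q]
  πQ : Q → M
  isPrincipalBundle : IsPrincipalBundle n k dim G' πQ
  /-- The spinor map. -/
  u : Q → P
  smooth_u : ContMDiff (𝓡 dim) (𝓡 d) ∞ u
  proj_u : ∀ q : Q, πP (u q) = πQ q
  equivariant_u : ∀ (q : Q) (g : G'),
    u (MulOpposite.op g • q) = MulOpposite.op (ρ g) • u q

/-- The group `Γ` is the internal direct product of its subgroups `K` and `L`. -/
structure IsInternalDirectProduct {Γ : Type*} [Group Γ] (K L : Subgroup Γ) : Prop where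
  commute : ∀ x ∈ K, ∀ y ∈ L, x * y = y * x
  inf_eq_bot : K ⊓ L = ⊥
  sup_eq_top : K ⊔ L = ⊤

namespace IsPrincipalBundle

variable {n k d : ℕ}
  {M : Type uM} [TopologicalSpace M] [ChartedSpace (EuclideanSpace ℝ (Fin n)) M]
  {G : Type uG} [Group G] [TopologicalSpace G] [ChartedSpace (EuclideanSpace ℝ (Fin k)) G]
  {P : Type uP} [TopologicalSpace P] [ChartedSpace (EuclideanSpace ℝ (Fin d)) P]
  [MulAction Gᵐᵒᵖ P] {π : P → M}

/-- The projection as a continuous map. -/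
def projMap (h : IsPrincipalBundle n k d G π) : C(P, M) :=
  ⟨π, h.smooth_proj.continuous⟩

/-- The map `i : G → P`, `i g = p₀ g`. -/
def orbitMap (h : IsPrincipalBundle n k d G π) (p₀ : P) : C(G, P) :=
  ⟨fun g => MulOpposite.op g • p₀,
    h.smooth_action.continuous.comp (Continuous.prodMk_right p₀)⟩

theorem orbitMap_one (h : IsPrincipalBundle n k d G π) (p₀ : P) : h.orbitMap p₀ 1 = p₀ :=
  one_smul Gᵐᵒᵖ p₀

/-- The homomorphism `π₁(P, p₀) → π₁(M, π p₀)` induced by the projection. -/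
noncomputable def projPi1 (h : IsPrincipalBundle n k d G π) (p₀ : P) :
    FundamentalGroup P p₀ →* FundamentalGroup M (π p₀) :=
  FundamentalGroup.map h.projMap p₀

/-- The homomorphism `i_* : π₁(G, 1) → π₁(P, p₀)` induced by `g ↦ p₀ g`. -/
noncomputable def orbitPi1 (h : IsPrincipalBundle n k d G π) (p₀ : P) :
    FundamentalGroup G (1 : G) →* FundamentalGroup P p₀ :=
  FundamentalGroup.mapOfEq (h.orbitMap p₀) (h.orbitMap_one p₀)

end IsPrincipalBundle

/-!
Both conditions are equivalent to `i_* : π₁(G) → π₁(P)` having a left inverse. For the condition on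
`K` and `I` this is algebra: translating paths by loops in `G` shows that the image of `i_*` is
central, and `π₁(G) → π₁(P) → π₁(M) → 1` is exact. Exactness at `π₁(P)` is obtained without lifting
homotopies: the homomorphism from `π₁(P)` to `π₁(P) / i_* π₁(G)` kills the loops lying over small
open subsets of `M`, so it is the monodromy of a covering of `M` and factors through `π₁(M)`.

The spinor map of a spinor structure is a covering of `P` by the action of `ker ρ`, which is also
the deck group of `ρ`. As the monodromy of `i_* b` acts on its fibres through the deck
transformation of `b`, the monodromy homomorphism `π₁(P) → ker ρ ≅ π₁(G)` is a left inverse of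
`i_*`.

Conversely, let `r` be a left inverse of `i_*` and `u : Q → P` the covering with fibre `i_* π₁(G)`
and monodromy `i_* ∘ r`. The action of `G̃` on `P` through `ρ` lifts to `Q` because `G̃` is simply
connected. The loops `i_* b` permute each fibre of `u` simply transitively, and their monodromy is
the action of the elements of `ker ρ`; hence `G̃` acts freely on `Q`, with the fibres of `π_P ∘ u`
as orbits.
-/

open Set Topology Filter

section Topology

variable {X Y : Type*} [TopologicalSpace X] [TopologicalSpace Y]

theorem exists_isCompact_forall_inter_nonempty_subset {ι : Type*} {V : ι → Set X}
    (hV : LocallyFinite V) (hc : ∀ i, IsCompact (closure (V i))) {C : Set X} (hC : IsCompact C) :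
    ∃ C', IsCompact C' ∧ ∀ i, (V i ∩ C).Nonempty → V i ⊆ C' :=
  ⟨⋃ i ∈ {i | (V i ∩ C).Nonempty}, closure (V i),
    (hV.finite_nonempty_inter_compact hC).isCompact_biUnion fun _ _ => hc _,
    fun _ hi => subset_closure.trans (subset_biUnion_of_mem (u := fun i => closure (V i)) hi)⟩

theorem exists_locallyFinite_cover_isCompact_closure (X : Type*) [TopologicalSpace X] [T2Space X]
    [LocallyCompactSpace X] [ParacompactSpace X] :
    ∃ V : X → Set X, (∀ x, IsOpen (V x)) ∧ ⋃ x, V x = univ ∧ LocallyFinite V ∧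
      ∀ x, IsCompact (closure (V x)) := by
  choose K hK hxK using fun x : X => exists_compact_mem_nhds x
  obtain ⟨V, hVo, hVc, hVlf, hVK⟩ := precise_refinement (fun x => interior (K x))
    (fun x => isOpen_interior)
    (eq_univ_of_forall fun x => mem_iUnion.2 ⟨x, mem_interior_iff_mem_nhds.2 (hxK x)⟩)
  exact ⟨V, hVo, hVc, hVlf, fun x => (hK x).closure_of_subset ((hVK x).trans interior_subset)⟩

theorem sigmaCompactSpace_of_connectedSpace_of_paracompactSpace (X : Type*) [TopologicalSpace X]
    [T2Space X] [LocallyCompactSpace X] [ParacompactSpace X] [ConnectedSpace X] :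
    SigmaCompactSpace X := by
  obtain ⟨V, hVo, hVc, hVlf, hVK⟩ := exists_locallyFinite_cover_isCompact_closure X
  choose! next hnext hsub using
    fun C : Set X => exists_isCompact_forall_inter_nonempty_subset hVlf hVK (C := C)
  obtain ⟨x₀⟩ := (inferInstance : Nonempty X)
  let C : ℕ → Set X := fun m => next^[m] {x₀}
  have hC_succ (m : ℕ) : C (m + 1) = next (C m) := Function.iterate_succ_apply' ..
  have hC (m : ℕ) : IsCompact (C m) := by
    induction m with
    | zero => exact isCompact_singleton
    | succ m ih => exact hC_succ m ▸ hnext _ ih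
  have hV_subset (m : ℕ) (i : X) (hi : (V i ∩ C m).Nonempty) : V i ⊆ ⋃ m, C m :=
    (hsub _ (hC m) i hi).trans (hC_succ m ▸ subset_iUnion C (m + 1))
  have hcov (x : X) : ∃ i, x ∈ V i := mem_iUnion.1 (hVc ▸ mem_univ x)
  refine ⟨⟨C, hC, IsClopen.eq_univ ⟨isClosed_of_closure_subset fun x hx => ?_,
    isOpen_iff_mem_nhds.2 fun x hx => ?_⟩ ⟨x₀, mem_iUnion.2 ⟨0, rfl⟩⟩⟩⟩ <;>
    obtain ⟨i, hi⟩ := hcov x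
  · obtain ⟨y, hyV, hy⟩ := mem_closure_iff.1 hx (V i) (hVo i) hi
    obtain ⟨m, hm⟩ := mem_iUnion.1 hy
    exact hV_subset m i ⟨y, hyV, hm⟩ hi
  · obtain ⟨m, hm⟩ := mem_iUnion.1 hx
    exact mem_of_superset ((hVo i).mem_nhds hi) (hV_subset m i ⟨x, hi, hm⟩)

theorem secondCountableTopology_of_connectedSpace_of_paracompactSpace {H : Type*}
    [TopologicalSpace H] [LocallyCompactSpace H] [SecondCountableTopology H] [T2Space X]
    [ParacompactSpace X] [ConnectedSpace X] [ChartedSpace H X] : SecondCountableTopology X :=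
  have : LocallyCompactSpace X := ChartedSpace.locallyCompactSpace H X
  have := sigmaCompactSpace_of_connectedSpace_of_paracompactSpace X
  ChartedSpace.secondCountable_of_sigmaCompact H X

theorem t2Space_of_isSeparatedMap [T2Space Y] {f : X → Y} (hf : IsSeparatedMap f)
    (hc : Continuous f) : T2Space X where
  t2 x x' hne := by
    by_cases h : f x = f x'
    · exact hf x x' h hne
    · exact separated_by_continuous hc h

theorem isSimplyConnected_target (e : OpenPartialHomeomorph X Y)
    (h : IsSimplyConnected e.source) : IsSimplyConnected e.target :=
  have : SimplyConnectedSpace e.source := h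
  e.toHomeomorphSourceTarget.symm.toHomotopyEquiv.simplyConnectedSpace

theorem exists_isSimplyConnected_nhds (E : Type*) [NormedAddCommGroup E] [NormedSpace ℝ E]
    [ChartedSpace E X] (x : X) {U : Set X} (hU : U ∈ 𝓝 x) :
    ∃ V ⊆ U, IsOpen V ∧ x ∈ V ∧ IsSimplyConnected V := by
  let e := chartAt E x
  have hx : x ∈ e.source := mem_chart_source E x
  have hUe : e.symm ⁻¹' U ∩ e.target ∈ 𝓝 (e x) :=
    inter_mem ((e.continuousAt_symm (e.map_source hx)).preimage_mem_nhds (by rwa [e.left_inv hx]))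
      (e.open_target.mem_nhds (e.map_source hx))
  obtain ⟨r, hr, hball⟩ := Metric.mem_nhds_iff.1 hUe
  let f := e.symm.restrOpen (Metric.ball (e x) r) Metric.isOpen_ball
  have hf : f.source = Metric.ball (e x) r := inter_eq_right.2 fun z hz => (hball hz).2
  refine ⟨f.target, fun z hz => ?_, f.open_target, ?_, isSimplyConnected_target f ?_⟩
  · have := hball (hf ▸ f.map_target hz)
    exact f.right_inv hz ▸ this.1
  · have : f (e x) = x := e.left_inv hx
    exact this ▸ f.map_source (hf ▸ Metric.mem_ball_self hr)
  · have : ContractibleSpace (Metric.ball (e x) r) :=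
      (convex_ball (e x) r).contractibleSpace ⟨_, Metric.mem_ball_self hr⟩
    rw [hf]
    exact (inferInstance : SimplyConnectedSpace (Metric.ball (e x) r))

end Topology

section LocalDiffeomorphisms

variable {H : Type*} [TopologicalSpace H] {Q P : Type*} [TopologicalSpace Q] [TopologicalSpace P]
  [ChartedSpace H P] {u : Q → P}

/-- The charts of `P` pulled back to charts of `Q` along a local homeomorphism `u : Q → P`. -/
noncomputable abbrev pullbackChartedSpace (hu : IsLocalHomeomorph u) : ChartedSpace H Q where
  atlas := {c | ∃ q, c = (hu q).choose.trans (chartAt H (u q))}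
  chartAt q := (hu q).choose.trans (chartAt H (u q))
  mem_chart_source q :=
    ⟨(hu q).choose_spec.1, by
      rw [mem_preimage, OpenPartialHomeomorph.symm_symm, ← (hu q).choose_spec.2]
      exact mem_chart_source H (u q)⟩
  chart_mem_atlas q := ⟨q, rfl⟩

theorem hasGroupoid_pullbackChartedSpace (𝒢 : StructureGroupoid H) [ClosedUnderRestriction 𝒢]
    [HasGroupoid P 𝒢] (hu : IsLocalHomeomorph u) :
    @HasGroupoid H _ Q _ (pullbackChartedSpace hu) 𝒢 := by
  let := pullbackChartedSpace (H := H) hu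
  refine ⟨?_⟩
  rintro _ _ ⟨q, rfl⟩ ⟨q', rfl⟩
  obtain ⟨-, h⟩ := (hu q).choose_spec
  obtain ⟨-, h'⟩ := (hu q').choose_spec
  set f := (hu q).choose
  set f' := (hu q').choose
  set c := chartAt H (u q)
  set c' := chartAt H (u q')
  have hff' : ∀ y ∈ f.target, f' (f.symm y) = y := fun y hy => by
    rw [← h', h, f.right_inv hy]
  have hmem := closedUnderRestriction' (HasGroupoid.compatible (G := 𝒢) (chart_mem_atlas H (u q))
    (chart_mem_atlas H (u q'))) ((f.trans c).symm.trans (f'.trans c')).open_source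
  refine 𝒢.mem_of_eqOnSource hmem ⟨?_, fun z hz => ?_⟩
  · rw [OpenPartialHomeomorph.restr_source' _ _ (OpenPartialHomeomorph.open_source _)]
    refine (inter_eq_right.2 fun z hz => ?_).symm
    simp only [mfld_simps] at hz ⊢
    rw [hff' _ hz.1.2] at hz
    exact ⟨hz.1.1, hz.2.2⟩
  · simp only [mfld_simps] at hz ⊢
    rw [hff' _ hz.1.2]

variable {E : Type*} [NormedAddCommGroup E] [NormedSpace ℝ E] {I : ModelWithCorners ℝ E H}
  {n : WithTop ℕ∞}

theorem isManifold_pullbackChartedSpace [IsManifold I n P] (hu : IsLocalHomeomorph u) :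
    @IsManifold ℝ _ E _ _ H _ I n Q _ (pullbackChartedSpace hu) :=
  let := pullbackChartedSpace (H := H) hu
  have := hasGroupoid_pullbackChartedSpace (contDiffGroupoid n I) hu
  { }

/-- A chart of a manifold as a diffeomorphism between its source and its target. -/
def partialDiffeomorphOfMemMaximalAtlas {c : OpenPartialHomeomorph P H}
    (hc : c ∈ IsManifold.maximalAtlas I n P) : PartialDiffeomorph I I P H n where
  toPartialEquiv := c.toPartialEquiv
  open_source := c.open_source
  open_target := c.open_target
  contMDiffOn_toFun := contMDiffOn_of_mem_maximalAtlas hc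
  contMDiffOn_invFun := contMDiffOn_symm_of_mem_maximalAtlas hc

theorem isLocalDiffeomorph_pullbackChartedSpace [IsManifold I n P] (hu : IsLocalHomeomorph u) :
    letI := pullbackChartedSpace (H := H) hu
    IsLocalDiffeomorph I I n u := by
  let := pullbackChartedSpace (H := H) hu
  have := isManifold_pullbackChartedSpace (I := I) (n := n) hu
  intro q
  obtain ⟨hq, hf⟩ := (hu q).choose_spec
  set f := (hu q).choose
  let φ := partialDiffeomorphOfMemMaximalAtlas
    (IsManifold.chart_mem_maximalAtlas (I := I) (n := n) (H := H) q)
  let ψ := partialDiffeomorphOfMemMaximalAtlas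
    (IsManifold.chart_mem_maximalAtlas (I := I) (n := n) (H := H) (u q))
  have hsource {z : Q} (hz : z ∈ φ.source) : u z ∈ ψ.source := congrFun hf z ▸ hz.2
  have hφψ {z : Q} : φ z = ψ (u z) := congrArg ψ (congrFun hf z).symm
  refine ⟨φ.trans ψ.symm, ⟨mem_chart_source H q, ?_⟩, fun z hz => ?_⟩
  · change φ q ∈ ψ.target
    rw [hφψ]
    exact ψ.map_source (hsource (mem_chart_source H q))
  · exact ((congrArg ψ.symm hφψ).trans (ψ.left_inv (hsource hz.1))).symm

variable {E' : Type*} [NormedAddCommGroup E'] [NormedSpace ℝ E'] {H' : Type*} [TopologicalSpace H']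
  {I' : ModelWithCorners ℝ E' H'} {N : Type*} [TopologicalSpace N] [ChartedSpace H' N]

theorem contMDiffAt_of_comp_isLocalDiffeomorphAt [ChartedSpace H Q] {f : N → Q} {x : N}
    (hu : IsLocalDiffeomorphAt I I n u (f x)) (hf : ContinuousAt f x)
    (huf : ContMDiffAt I' I n (u ∘ f) x) : ContMDiffAt I' I n f x :=
  (hu.localInverse_contMDiffAt.comp x huf).congr_of_eventuallyEq <|
    (hf.eventually hu.localInverse_eventuallyEq_left).mono fun _ h => h.symm

end LocalDiffeomorphisms

section Coverings

theorem eventually_subpath_mem {X : Type*} [TopologicalSpace X] {x y : X} (γ : Path x y)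
    {t₀ : unitInterval} {U : Set X} (hU : U ∈ 𝓝 (γ t₀)) :
    ∀ᶠ t in 𝓝 t₀, ∀ r, γ.subpath t₀ t r ∈ U ∧ γ.subpath t t₀ r ∈ U := by
  filter_upwards [tendsto_smallSets_iff.1 (tendsto_const_nhds.uIcc tendsto_id) _
    (γ.continuous.continuousAt.preimage_mem_nhds hU)] with t ht r
  have hsub (s s' : unitInterval) (h : uIcc s s' ⊆ γ ⁻¹' U) : γ.subpath s s' r ∈ U :=
    (range_subset_iff.1 ((γ.range_subpath s s').trans_subset (image_subset_iff.2 h))) r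
  exact ⟨hsub _ _ ht, hsub _ _ (uIcc_comm t t₀ ▸ ht)⟩

/-- A transport of a group `A` along paths in `Y`: a functor from the fundamental groupoid of `Y` to
`A`. The reversed order in `val_trans` is that of the multiplication of `FundamentalGroup`. -/
structure PathTransport (Y A : Type*) [TopologicalSpace Y] [Group A] where
  val : ∀ {y y' : Y}, Path.Homotopic.Quotient y y' → A
  val_trans : ∀ {y y' y'' : Y} (c : Path.Homotopic.Quotient y y')
    (c' : Path.Homotopic.Quotient y' y''), val (c.trans c') = val c' * val c

namespace PathTransport

variable {X Y A : Type*} [TopologicalSpace X] [TopologicalSpace Y] [Group A]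

/-- The transport given by a homomorphism `φ` on the fundamental group and a choice of path classes
`γ y` from the base point to all points. -/
noncomputable def ofHom {y₀ : Y} (φ : FundamentalGroup Y y₀ →* A)
    (γ : ∀ y, Path.Homotopic.Quotient y₀ y) : PathTransport Y A where
  val {y y'} c := φ ((γ y).trans (c.trans (γ y').symm))
  val_trans {y y' y''} c c' := by
    rw [← map_mul, FundamentalGroup.mul_def]
    simp only [Path.Homotopic.Quotient.trans_assoc]
    rw [← Path.Homotopic.Quotient.trans_assoc (γ y').symm, Path.Homotopic.Quotient.symm_trans,
      Path.Homotopic.Quotient.refl_trans]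

theorem ofHom_val_of_eq_refl {y₀ : Y} (φ : FundamentalGroup Y y₀ →* A)
    {γ : ∀ y, Path.Homotopic.Quotient y₀ y} (hγ : γ y₀ = .refl y₀) (c : FundamentalGroup Y y₀) :
    (ofHom φ γ).val c = φ c := by
  change φ ((γ y₀).trans (c.toPath.trans (γ y₀).symm)) = φ c
  rw [hγ, ← Path.Homotopic.Quotient.mk_refl, ← Path.Homotopic.Quotient.mk_symm, Path.refl_symm,
    Path.Homotopic.Quotient.mk_refl, Path.Homotopic.Quotient.trans_refl,
    Path.Homotopic.Quotient.refl_trans]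

variable (T : PathTransport Y A)

@[simp]
theorem val_refl (y : Y) : T.val (.refl y) = 1 := by
  have h := T.val_trans (.refl y) (.refl y)
  rw [Path.Homotopic.Quotient.trans_refl] at h
  exact left_eq_mul.1 h

theorem val_symm {y y' : Y} (c : Path.Homotopic.Quotient y y') : T.val c.symm = (T.val c)⁻¹ := by
  rw [eq_inv_iff_mul_eq_one, ← T.val_trans, Path.Homotopic.Quotient.trans_symm, val_refl]

@[simp]
theorem val_cast {y y' z z' : Y} (c : Path.Homotopic.Quotient y y') (h : z = y) (h' : z' = y') :
    T.val (c.cast h h') = T.val c := by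
  subst h h'
  rw [Path.Homotopic.Quotient.cast_rfl_rfl]

theorem val_subpath_mul {y y' : Y} (δ : Path y y') (r s t : unitInterval) :
    T.val (.mk (δ.subpath s t)) * T.val (.mk (δ.subpath r s)) = T.val (.mk (δ.subpath r t)) := by
  rw [← T.val_trans, ← Path.Homotopic.Quotient.mk_trans]
  exact congrArg T.val (Path.Homotopic.Quotient.eq.2 ⟨Path.Homotopy.subpathTransSubpath δ r s t⟩)

/-- `κ` is a potential for the transport `T` on `S` if along paths in `S` the transport is the
difference of the values of `κ` at the two ends. -/
def IsPotential (S : Set Y) (κ : Y → A) : Prop :=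
  ∀ ⦃y y'⦄ (δ : Path y y'), (∀ t, δ t ∈ S) → T.val (.mk δ) * κ y = κ y'

theorem exists_isPotential {S : Set Y} (hS : IsPathConnected S)
    (h : ∀ y (δ : Path y y), (∀ t, δ t ∈ S) → T.val (.mk δ) = 1) : ∃ κ, T.IsPotential S κ := by
  obtain ⟨y₀, -, hy₀⟩ := hS
  have hpath (y : Y) (hy : y ∈ S) : ∃ a, ∃ γ : Path y₀ y, (∀ t, γ t ∈ S) ∧ T.val (.mk γ) = a :=
    let ⟨γ, hγ⟩ := hy₀ hy; ⟨_, γ, hγ, rfl⟩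
  choose! κ hκ using hpath
  refine ⟨κ, fun y y' δ hδ => ?_⟩
  obtain ⟨γ, hγ, hγκ⟩ := hκ y (δ.source ▸ hδ 0)
  obtain ⟨γ', hγ', hγκ'⟩ := hκ y' (δ.target ▸ hδ 1)
  have hloop := h y₀ ((γ.trans δ).trans γ'.symm) fun t => by
    have ht : (γ.trans δ).trans γ'.symm t ∈ (range γ ∪ range δ) ∪ range γ' := by
      rw [← Path.symm_range γ', ← Path.trans_range, ← Path.trans_range]
      exact mem_range_self t
    exact union_subset (union_subset (range_subset_iff.2 hγ) (range_subset_iff.2 hδ))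
      (range_subset_iff.2 hγ') ht
  rw [Path.Homotopic.Quotient.mk_trans, Path.Homotopic.Quotient.mk_trans,
    Path.Homotopic.Quotient.mk_symm, T.val_trans, T.val_trans, T.val_symm, hγκ, hγκ'] at hloop
  exact (inv_mul_eq_one.1 hloop).symm

variable {T} in
theorem IsPotential.inv_mul_eq_of_joinedIn {S : Set Y} {κ κ' : Y → A} (h : T.IsPotential S κ)
    (h' : T.IsPotential S κ') {y y' : Y} (hyy' : JoinedIn S y y') :
    (κ' y)⁻¹ * κ y = (κ' y')⁻¹ * κ y' := by
  obtain ⟨δ, hδ⟩ := hyy'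
  rw [← h δ hδ, ← h' δ hδ]
  group

variable {T} in
theorem IsPotential.mono {S S' : Set Y} {κ : Y → A} (h : T.IsPotential S κ) (hS : S' ⊆ S) :
    T.IsPotential S' κ :=
  fun _ _ δ hδ => h δ fun t => hS (hδ t)

/-- Potentials for the transport `T` over the members of an open cover of `X`, where
`f : Y → X` has arbitrarily small path connected preimages of neighbourhoods. Dividing the
potentials by one another gives the transition functions of a covering of `X` with fibre `A`. -/
structure PotentialAtlas (f : C(Y, X)) where
  surjective : Function.Surjective f
  exists_isPathConnected : ∀ x, ∀ U ∈ 𝓝 x, ∃ V ∈ 𝓝 x, V ⊆ U ∧ IsPathConnected (f ⁻¹' V)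
  baseSet : X → Set X
  isOpen_baseSet : ∀ x, IsOpen (baseSet x)
  mem_baseSet : ∀ x, x ∈ baseSet x
  potential : X → Y → A
  isPotential : ∀ x, T.IsPotential (f ⁻¹' baseSet x) (potential x)

theorem nonempty_potentialAtlas {f : C(Y, X)} (hf : Function.Surjective f)
    (hV : ∀ x, ∀ U ∈ 𝓝 x, ∃ V ⊆ U, IsOpen V ∧ x ∈ V ∧ IsPathConnected (f ⁻¹' V) ∧
      ∀ y (δ : Path y y), (∀ t, f (δ t) ∈ V) → T.val (.mk δ) = 1) :
    Nonempty (T.PotentialAtlas f) := by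
  choose V hVo hxV hVc hVT using fun x => (hV x univ univ_mem).imp fun V h => h.2
  choose κ hκ using fun x => T.exists_isPotential (hVc x) (hVT x)
  exact ⟨⟨hf, fun x U hU => let ⟨W, hWU, hWo, hxW, hW, _⟩ := hV x U hU
    ⟨W, hWo.mem_nhds hxW, hWU, hW⟩, V, hVo, hxV, κ, hκ⟩⟩

namespace PotentialAtlas

variable {T} {f : C(Y, X)} (a : T.PotentialAtlas f)

include a in
theorem eventually_joinedIn_preimage {x : X} {U : Set X} (hU : U ∈ 𝓝 x) :
    ∀ᶠ x' in 𝓝 x, ∀ y y', f y = x → f y' = x' → JoinedIn (f ⁻¹' U) y y' := by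
  obtain ⟨V, hV, hVU, hVc⟩ := a.exists_isPathConnected x U hU
  filter_upwards [hV] with x' hx' y y' hy hy'
  exact (hVc.joinedIn y (hy ▸ mem_of_mem_nhds hV :) y' (hy' ▸ hx' :)).mono (preimage_mono hVU)

theorem inv_mul_potential_eventuallyEq {i j x : X} (hi : x ∈ a.baseSet i) (hj : x ∈ a.baseSet j) :
    ∀ᶠ x' in 𝓝 x, ∀ y y', f y = x → f y' = x' →
      (a.potential j y)⁻¹ * a.potential i y = (a.potential j y')⁻¹ * a.potential i y' :=
  (a.eventually_joinedIn_preimage (inter_mem ((a.isOpen_baseSet i).mem_nhds hi)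
    ((a.isOpen_baseSet j).mem_nhds hj))).mono fun _ h y y' hy hy' =>
      ((a.isPotential i).mono fun _ hz => hz.1).inv_mul_eq_of_joinedIn
        ((a.isPotential j).mono fun _ hz => hz.2) (h y y' hy hy')

variable [TopologicalSpace A] [DiscreteTopology A]

/-- The covering with fibre `A` glued from the quotients of the potentials, which are evaluated at
an arbitrary point `Function.surjInv a.surjective x` over `x`. -/
noncomputable def core : FiberBundleCore X X A where
  baseSet := a.baseSet
  isOpen_baseSet := a.isOpen_baseSet
  indexAt := id
  mem_baseSet_at := a.mem_baseSet
  coordChange i j x v := (a.potential j (Function.surjInv a.surjective x))⁻¹ *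
    a.potential i (Function.surjInv a.surjective x) * v
  coordChange_self i x _ v := by group
  continuousOn_coordChange i j := by
    rintro ⟨x, v⟩ ⟨⟨hi, hj⟩, -⟩
    have hmul : Continuous fun w : A => (a.potential j (Function.surjInv a.surjective x))⁻¹ *
      a.potential i (Function.surjInv a.surjective x) * w := continuous_of_discreteTopology
    refine ((hmul.comp continuous_snd).continuousAt.congr ?_).continuousWithinAt
    filter_upwards [continuousAt_fst.eventually (a.inv_mul_potential_eventuallyEq hi hj)] with z hz
    exact congrArg (· * z.2) (hz _ _ (Function.surjInv_eq _ _) (Function.surjInv_eq _ _))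
  coordChange_comp i j k x _ v := by group

/-- The point over `f y` whose coordinate in the chart `i` is `(a.potential i y)⁻¹ * v`. -/
noncomputable def point (y : Y) (v : A) : a.core.TotalSpace :=
  ⟨f y, ((a.potential (f y) y)⁻¹ * v : A)⟩

theorem localTrivAt_point_snd {i : X} {y : Y} (hy : f y ∈ a.baseSet i) (v : A) :
    (a.core.localTrivAt i (a.point y v)).2 = (a.potential i y)⁻¹ * v := by
  have h := (a.inv_mul_potential_eventuallyEq (a.mem_baseSet (f y)) hy).self_of_nhds
    _ _ (Function.surjInv_eq a.surjective (f y)) rfl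
  rw [a.core.localTrivAt_snd]
  change (a.potential i (Function.surjInv a.surjective (f y)))⁻¹ *
    a.potential (f y) (Function.surjInv a.surjective (f y)) * ((a.potential (f y) y)⁻¹ * v) = _
  rw [h]
  group

theorem bijective_point (y : Y) : Function.Bijective fun v : A =>
    (⟨a.point y v, rfl⟩ : (Bundle.TotalSpace.proj (F := A) (E := a.core.Fiber)) ⁻¹' {f y}) := by
  refine ⟨fun v w h => ?_, ?_⟩
  · have h' : (a.potential (f y) y)⁻¹ * v = (a.potential (f y) y)⁻¹ * w :=
      Bundle.TotalSpace.mk_inj.1 (congrArg Subtype.val h : a.point y v = a.point y w)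
    exact mul_left_cancel h'
  · rintro ⟨⟨x, v⟩, rfl : x = f y⟩
    let v : A := v
    exact ⟨a.potential (f y) y * v, Subtype.ext (congrArg (Bundle.TotalSpace.mk (f y))
      (inv_mul_cancel_left (a.potential (f y) y) v))⟩

theorem continuous_point_subpath {y y' : Y} (δ : Path y y') (v : A) :
    Continuous fun t => a.point (δ t) (T.val (.mk (δ.subpath 0 t)) * v) := by
  refine continuous_iff_continuousAt.2 fun t₀ => (FiberBundle.continuousAt_totalSpace _ _).2
    ⟨(f.continuous.comp δ.continuous).continuousAt, ?_⟩
  set x := f (δ t₀)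
  have hU : f ⁻¹' a.baseSet x ∈ 𝓝 (δ t₀) :=
    f.continuous.continuousAt.preimage_mem_nhds ((a.isOpen_baseSet x).mem_nhds (a.mem_baseSet x))
  refine ContinuousAt.congr (f := fun _ => (a.potential x (δ t₀))⁻¹ *
    (T.val (.mk (δ.subpath 0 t₀)) * v)) continuousAt_const ?_
  filter_upwards [eventually_subpath_mem δ hU, δ.continuous.continuousAt hU] with t hδ hδt
  refine Eq.trans ?_ (a.localTrivAt_point_snd hδt _).symm
  rw [← a.isPotential x _ fun r => (hδ r).1, ← T.val_subpath_mul δ 0 t₀ t]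
  group

/-- The lift to the covering of the image in `X` of a path in `Y`. -/
noncomputable def liftPath {y y' : Y} (δ : Path y y') (v : A) :
    Path (a.point y v) (a.point y' (T.val (.mk δ) * v)) where
  toFun t := a.point (δ t) (T.val (.mk (δ.subpath 0 t)) * v)
  continuous_toFun := a.continuous_point_subpath δ v
  source' := by
    rw [Path.subpath_self, Path.Homotopic.Quotient.mk_refl, T.val_refl, one_mul, δ.source]
  target' := by
    rw [Path.subpath_zero_one, Path.Homotopic.Quotient.mk_cast, T.val_cast, δ.target]

end PotentialAtlas

theorem PotentialAtlas.exists_isCoveringMap_monodromy {X : Type uM} {A : Type uG}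
    [TopologicalSpace X] [Group A] {T : PathTransport Y A} {f : C(Y, X)} (a : T.PotentialAtlas f) :
    ∃ (E : Type max uM uG) (_ : TopologicalSpace E) (p : E → X) (cov : IsCoveringMap p)
      (mk : ∀ y, A ≃ p ⁻¹' {f y}), ∀ y y' (c : Path.Homotopic.Quotient y y') (v : A),
        cov.monodromy (c.map f) (mk y v) = mk y' (T.val c * v) := by
  let : TopologicalSpace A := ⊥
  have : DiscreteTopology A := ⟨rfl⟩
  refine ⟨_, inferInstance, Bundle.TotalSpace.proj (F := A) (E := a.core.Fiber),
    FiberBundle.isCoveringMap, fun y => .ofBijective _ (a.bijective_point y), fun y y' c v => ?_⟩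
  induction c using Path.Homotopic.Quotient.ind with
  | mk δ => exact IsCoveringMap.monodromy_eq_of_map_eq _ (.mk (a.liftPath δ v)) rfl

end PathTransport

theorem exists_isCoveringMap_monodromy_eq {Y : Type*} {X : Type uM} {A : Type uG}
    [TopologicalSpace Y] [PathConnectedSpace Y] [TopologicalSpace X] [Group A] {f : C(Y, X)}
    (hf : Function.Surjective f) {y₀ : Y} (φ : FundamentalGroup Y y₀ →* A)
    (hV : ∀ x, ∀ U ∈ 𝓝 x, ∃ V ⊆ U, IsOpen V ∧ x ∈ V ∧ IsPathConnected (f ⁻¹' V) ∧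
      ∀ y (δ : Path y y) (γ : Path.Homotopic.Quotient y₀ y), (∀ t, f (δ t) ∈ V) →
        φ (γ.trans (.trans (.mk δ) γ.symm)) = 1) :
    ∃ (E : Type max uM uG) (_ : TopologicalSpace E) (p : E → X) (cov : IsCoveringMap p)
      (mk : ∀ y, A ≃ p ⁻¹' {f y}), ∀ (c : FundamentalGroup Y y₀) (v : A),
        cov.monodromy (FundamentalGroup.map f y₀ c) (mk y₀ v) = mk y₀ (φ c * v) := by
  let γ (y : Y) : Path.Homotopic.Quotient y₀ y := .trans
    (.symm (.mk (PathConnectedSpace.somePath y₀ y₀))) (.mk (PathConnectedSpace.somePath y₀ y))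
  have hγ : γ y₀ = .refl y₀ := Path.Homotopic.Quotient.symm_trans _
  obtain ⟨a⟩ := (PathTransport.ofHom φ γ).nonempty_potentialAtlas hf fun x U hU =>
    let ⟨V, hVU, hVo, hxV, hVc, hVφ⟩ := hV x U hU
    ⟨V, hVU, hVo, hxV, hVc, fun y δ hδ => hVφ y δ (γ y) hδ⟩
  obtain ⟨E, _, p, cov, mk, hmk⟩ := a.exists_isCoveringMap_monodromy
  refine ⟨E, _, p, cov, mk, fun c v => (hmk y₀ y₀ c v).trans ?_⟩
  rw [PathTransport.ofHom_val_of_eq_refl φ hγ]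

theorem homotopic_of_isSimplyConnected {X : Type*} [TopologicalSpace X] {V : Set X}
    (hV : IsSimplyConnected V) {x x' : X} {γ γ' : Path x x'} (hγ : ∀ t, γ t ∈ V)
    (hγ' : ∀ t, γ' t ∈ V) : γ.Homotopic γ' := by
  have := hV.simplyConnectedSpace
  let δ (ε : Path x x') (hε : ∀ t, ε t ∈ V) :
      Path (⟨x, ε.source ▸ hε 0⟩ : V) ⟨x', ε.target ▸ hε 1⟩ :=
    { toFun := fun t => ⟨ε t, hε t⟩
      continuous_toFun := ε.continuous.subtype_mk hε
      source' := Subtype.ext ε.source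
      target' := Subtype.ext ε.target }
  exact (SimplyConnectedSpace.paths_homotopic (δ γ hγ) (δ γ' hγ')).map ⟨_, continuous_subtype_val⟩

section LiftingPathClasses

variable {X Y : Type*} [TopologicalSpace X] [TopologicalSpace Y] {f : C(Y, X)}

theorem map_trans_eq_cast {x x' x'' : X} {y y' y'' : Y} (hy : f y = x) (hy' : f y' = x')
    (hy'' : f y'' = x'') {d : Path.Homotopic.Quotient y y'} {d' : Path.Homotopic.Quotient y' y''}
    {c : Path.Homotopic.Quotient x x'} {c' : Path.Homotopic.Quotient x' x''}
    (hd : d.map f = c.cast hy hy') (hd' : d'.map f = c'.cast hy' hy'') :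
    (d.trans d').map f = (c.trans c').cast hy hy'' := by
  subst hy hy' hy''
  rw [Path.Homotopic.Quotient.cast_rfl_rfl] at hd hd' ⊢
  rw [← hd, ← hd']
  exact (FundamentalGroupoid.map f).map_comp d d'

theorem exists_map_eq_of_isSimplyConnected {V : Set X} (hV : IsSimplyConnected V)
    (hfV : IsPathConnected (f ⁻¹' V)) {x x' : X} {γ : Path x x'} (hγ : ∀ t, γ t ∈ V) {y y' : Y}
    (hy : f y = x) (hy' : f y' = x') :
    ∃ d : Path.Homotopic.Quotient y y', d.map f = (Path.Homotopic.Quotient.mk γ).cast hy hy' := by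
  subst hy hy'
  obtain ⟨δ, hδ⟩ := hfV.joinedIn y (γ.source ▸ hγ 0 :) y' (γ.target ▸ hγ 1 :)
  exact ⟨.mk δ, Path.Homotopic.Quotient.eq.2
    (homotopic_of_isSimplyConnected (γ := δ.map f.continuous) hV hδ hγ)⟩

theorem exists_map_eq_of_forall_exists_nhds (hf : Function.Surjective f)
    (h : ∀ x, ∃ V ∈ 𝓝 x, IsSimplyConnected V ∧ IsPathConnected (f ⁻¹' V)) {y y' : Y}
    (c : Path.Homotopic.Quotient (f y) (f y')) :
    ∃ d : Path.Homotopic.Quotient y y', d.map f = c := by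
  induction c using Path.Homotopic.Quotient.ind with | mk γ
  have hlift (s t : unitInterval) : ∀ z z', ∀ (hz : f z = γ s) (hz' : f z' = γ t),
      ∃ d : Path.Homotopic.Quotient z z',
        d.map f = (Path.Homotopic.Quotient.mk (γ.subpath s t)).cast hz hz' := by
    refine PreconnectedSpace.induction₂' (fun s t => ∀ z z', ∀ (hz : f z = γ s) (hz' : f z' = γ t),
      ∃ d : Path.Homotopic.Quotient z z', d.map f = (Path.Homotopic.Quotient.mk
        (γ.subpath s t)).cast hz hz') (fun t₀ => ?_) ⟨fun r s t hrs hst z z' hz hz' => ?_⟩ s t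
    · obtain ⟨V, hV, hVs, hfV⟩ := h (γ t₀)
      filter_upwards [eventually_subpath_mem γ hV] with t ht
      exact ⟨fun _ _ => exists_map_eq_of_isSimplyConnected hVs hfV fun r => (ht r).1,
        fun _ _ => exists_map_eq_of_isSimplyConnected hVs hfV fun r => (ht r).2⟩
    · obtain ⟨z'', hz''⟩ := hf (γ s)
      obtain ⟨d, hd⟩ := hrs z z'' hz hz''
      obtain ⟨d', hd'⟩ := hst z'' z' hz'' hz'
      refine ⟨d.trans d', (map_trans_eq_cast hz hz'' hz' hd hd').trans ?_⟩
      rw [← Path.Homotopic.Quotient.mk_trans,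
        Path.Homotopic.Quotient.eq.2 ⟨Path.Homotopy.subpathTransSubpath γ r s t⟩]
  simpa using hlift 0 1 y y' γ.source.symm γ.target.symm

end LiftingPathClasses

end Coverings

section Trivializations

theorem isPathConnected_preimage_of_trivialization {B F Z : Type*} [TopologicalSpace B]
    [TopologicalSpace F] [TopologicalSpace Z] [PathConnectedSpace F] {π : Z → B}
    (e : Bundle.Trivialization F π) {V : Set B} (hV : IsPathConnected V) (hVe : V ⊆ e.baseSet) :
    IsPathConnected (π ⁻¹' V) := by
  have himage : e.toOpenPartialHomeomorph.symm '' V ×ˢ (univ : Set F) = π ⁻¹' V := by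
    refine Subset.antisymm (image_subset_iff.2 fun x hx => ?_) fun z hz =>
      ⟨e z, ⟨(e.coe_fst' (hVe hz)).symm ▸ hz, mem_univ _⟩, ?_⟩
    · rw [mem_preimage, mem_preimage, e.proj_symm_apply (e.mem_target.2 (hVe hx.1))]
      exact hx.1
    · exact e.left_inv (e.mem_source.2 (hVe hz))
  exact himage ▸ (hV.prod isPathConnected_univ).image'
    (e.toOpenPartialHomeomorph.continuousOn_symm.mono fun x hx => e.mem_target.2 (hVe hx.1))

variable {M G P : Type*} [TopologicalSpace M] [TopologicalSpace G] [TopologicalSpace P] [Group G]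
  [MulAction Gᵐᵒᵖ P] {π : P → M}

/-- The compatibility with the group action required of a trivialisation of a principal bundle. -/
def IsEquivariantTrivialization (e : Bundle.Trivialization G π) : Prop :=
  ∀ m ∈ e.baseSet, ∀ g : G, e.toOpenPartialHomeomorph.symm (m, g) =
    MulOpposite.op g • e.toOpenPartialHomeomorph.symm (m, (1 : G))

namespace IsEquivariantTrivialization

variable {e : Bundle.Trivialization G π} (he : IsEquivariantTrivialization e)
include he

theorem symm_mul {m : M} (hm : m ∈ e.baseSet) (g g' : G) :
    e.toOpenPartialHomeomorph.symm (m, g * g') =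
      MulOpposite.op g' • e.toOpenPartialHomeomorph.symm (m, g) := by
  rw [he m hm, he m hm g, MulOpposite.op_mul, mul_smul]

theorem apply_smul {p : P} (hp : π p ∈ e.baseSet) (g : G) :
    e (MulOpposite.op g • p) = (π p, (e p).2 * g) := by
  conv_lhs => rw [← e.symm_apply_mk_proj (e.mem_source.2 hp), ← he.symm_mul hp]
  exact e.apply_symm_apply' hp

end IsEquivariantTrivialization

end Trivializations

theorem pathConnectedSpace_of_chartedSpace (E X : Type*) [TopologicalSpace E]
    [LocallyPathConnectedSpace E] [TopologicalSpace X] [ChartedSpace E X] [ConnectedSpace X] :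
    PathConnectedSpace X :=
  have := ChartedSpace.locallyPathConnectedSpace E X
  pathConnectedSpace_iff_connectedSpace.2 ‹_›

namespace IsPrincipalBundle

variable {n k d : ℕ}
  {M : Type uM} [TopologicalSpace M] [ChartedSpace (EuclideanSpace ℝ (Fin n)) M]
  {G : Type uG} [Group G] [TopologicalSpace G] [ChartedSpace (EuclideanSpace ℝ (Fin k)) G]
  {P : Type uP} [TopologicalSpace P] [ChartedSpace (EuclideanSpace ℝ (Fin d)) P]
  [MulAction Gᵐᵒᵖ P] {π : P → M} (h : IsPrincipalBundle n k d G π)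
include h

theorem exists_isEquivariantTrivialization (m : M) :
    ∃ e : Bundle.Trivialization G π, m ∈ e.baseSet ∧ IsEquivariantTrivialization e :=
  let ⟨e, hm, _, _, he⟩ := h.locally_trivial m; ⟨e, hm, he⟩

theorem continuous_smul : Continuous fun x : P × G => MulOpposite.op x.2 • x.1 :=
  h.smooth_action.continuous

theorem isOpenMap_proj : IsOpenMap π :=
  isOpenMap_iff_nhds_le.2 fun p =>
    let ⟨e, he, _⟩ := h.locally_trivial (π p)
    (e.map_proj_nhds (e.mem_source.2 he)).ge

theorem preimage_singleton (p : P) : π ⁻¹' {π p} = range (h.orbitMap p) :=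
  Subset.antisymm (fun p' hp' => h.transitive p p' (mem_singleton_iff.1 hp').symm)
    (range_subset_iff.2 (h.proj_action p))

theorem pathConnectedSpace [ConnectedSpace M] [ConnectedSpace G] : PathConnectedSpace P := by
  have hquot : IsQuotientMap π :=
    h.isOpenMap_proj.isQuotientMap h.smooth_proj.continuous h.surjective_proj
  have hfiber (m : M) : IsConnected (π ⁻¹' {m}) := by
    obtain ⟨p, rfl⟩ := h.surjective_proj m
    exact h.preimage_singleton p ▸ isConnected_range (h.orbitMap p).continuous
  have : ConnectedSpace P := connectedSpace_iff_univ.2 <|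
    IsCoinducing.isConnected_preimage_of_isClosed hfiber hquot.isCoinducing isClosed_univ
      isConnected_univ
  exact pathConnectedSpace_of_chartedSpace (EuclideanSpace ℝ (Fin d)) P

theorem exists_isSimplyConnected_nhds [ConnectedSpace G] {m : M} {U : Set M} (hU : U ∈ 𝓝 m) :
    ∃ e : Bundle.Trivialization G π, IsEquivariantTrivialization e ∧ ∃ V ⊆ U, V ⊆ e.baseSet ∧
      IsOpen V ∧ m ∈ V ∧ IsSimplyConnected V ∧ IsPathConnected (π ⁻¹' V) := by
  have := pathConnectedSpace_of_chartedSpace (EuclideanSpace ℝ (Fin k)) G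
  obtain ⟨e, hm, he⟩ := h.exists_isEquivariantTrivialization m
  obtain ⟨V, hVU, hVo, hmV, hV⟩ := _root_.exists_isSimplyConnected_nhds
    (EuclideanSpace ℝ (Fin n)) m (inter_mem hU (e.open_baseSet.mem_nhds hm))
  exact ⟨e, he, V, fun _ hz => (hVU hz).1, fun _ hz => (hVU hz).2, hVo, hmV, hV,
    isPathConnected_preimage_of_trivialization e hV.isPathConnected fun _ hz => (hVU hz).2⟩

/-- The pointwise translate of a path in the total space by a loop in the group. -/
def smulPath {p p' : P} (γ : Path p p') (l : Path (1 : G) 1) : Path p p' where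
  toFun t := MulOpposite.op (l t) • γ t
  continuous_toFun := h.continuous_smul.comp (γ.continuous.prodMk l.continuous)
  source' := by rw [l.source, γ.source]; exact one_smul Gᵐᵒᵖ p
  target' := by rw [l.target, γ.target]; exact one_smul Gᵐᵒᵖ p'

theorem orbitPi1_mk (p : P) (l : Path (1 : G) 1) :
    (h.orbitPi1 p (FundamentalGroup.fromPath (.mk l))).toPath =
      .mk ((l.map (h.orbitMap p).continuous).cast (h.orbitMap_one p).symm
        (h.orbitMap_one p).symm) :=
  FundamentalGroup.mapOfEq_apply (h.orbitMap p) (h.orbitMap_one p) _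

theorem mk_smulPath {p p' : P} (γ : Path p p') (l : Path (1 : G) 1) :
    (Path.Homotopic.Quotient.mk (h.smulPath γ l) =
      .trans (.mk γ) (h.orbitPi1 p' (FundamentalGroup.fromPath (.mk l))).toPath) ∧
    Path.Homotopic.Quotient.mk (h.smulPath γ l) =
      (h.orbitPi1 p (FundamentalGroup.fromPath (.mk l))).toPath.trans (.mk γ) := by
  let smul : C(P × G, P) := ⟨_, h.continuous_smul⟩
  have hone (q : P) : smul (q, 1) = q := one_smul Gᵐᵒᵖ q
  have hγ : (Path.Homotopic.prod (.mk γ) (.refl 1)).map smul =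
      (Path.Homotopic.Quotient.mk γ).cast (hone p) (hone p') :=
    congrArg Path.Homotopic.Quotient.mk (Path.ext (funext fun t => hone (γ t)))
  have hl (q : P) : (Path.Homotopic.prod (.refl q) (.mk l)).map smul =
      (h.orbitPi1 q (FundamentalGroup.fromPath (.mk l))).toPath.cast (hone q) (hone q) := by
    rw [orbitPi1_mk]
    exact congrArg Path.Homotopic.Quotient.mk (Path.ext rfl)
  have hγl := map_trans_eq_cast (f := smul) (hone p) (hone p') (hone p') hγ (hl p')
  have hlγ := map_trans_eq_cast (f := smul) (hone p) (hone p) (hone p') (hl p) hγ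
  rw [Path.Homotopic.comp_prod_eq_prod_comp, Path.Homotopic.Quotient.trans_refl,
    Path.Homotopic.Quotient.refl_trans] at hγl hlγ
  have hprod : Path.Homotopic.Quotient.mk (h.smulPath γ l) =
      ((Path.Homotopic.prod (.mk γ) (.mk l)).map smul).cast (hone p).symm (hone p').symm :=
    congrArg Path.Homotopic.Quotient.mk (Path.ext rfl)
  constructor
  · rw [hprod, hγl, Path.Homotopic.Quotient.cast_cast, Path.Homotopic.Quotient.cast_rfl_rfl]
  · rw [hprod, hlγ, Path.Homotopic.Quotient.cast_cast, Path.Homotopic.Quotient.cast_rfl_rfl]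

theorem trans_orbitPi1 {p p' : P} (γ : Path.Homotopic.Quotient p p') (b : FundamentalGroup G 1) :
    γ.trans (h.orbitPi1 p' b).toPath = (h.orbitPi1 p b).toPath.trans γ := by
  obtain ⟨l, rfl⟩ := Path.Homotopic.Quotient.mk_surjective b
  obtain ⟨γ, rfl⟩ := Path.Homotopic.Quotient.mk_surjective γ
  exact (h.mk_smulPath γ l).1.symm.trans (h.mk_smulPath γ l).2

theorem orbitPi1_commute (p : P) (a : FundamentalGroup P p) (b : FundamentalGroup G 1) :
    Commute a (h.orbitPi1 p b) :=
  (h.trans_orbitPi1 a.toPath b).symm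

theorem normal_range_orbitPi1 (p : P) : (h.orbitPi1 p).range.Normal where
  conj_mem := by
    rintro _ ⟨b, rfl⟩ a
    exact ⟨b, by rw [(h.orbitPi1_commute p a b).eq, mul_inv_cancel_right]⟩

theorem projPi1_orbitPi1 (p : P) (b : FundamentalGroup G 1) :
    h.projPi1 p (h.orbitPi1 p b) = 1 := by
  obtain ⟨l, rfl⟩ := Path.Homotopic.Quotient.mk_surjective b
  change (h.orbitPi1 p (FundamentalGroup.fromPath (.mk l))).toPath.map h.projMap = _
  rw [orbitPi1_mk]
  exact congrArg Path.Homotopic.Quotient.mk (Path.ext (funext fun t => h.proj_action p (l t)))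

theorem surjective_projPi1 [ConnectedSpace G] (p : P) : Function.Surjective (h.projPi1 p) :=
  exists_map_eq_of_forall_exists_nhds (f := h.projMap) h.surjective_proj fun _ =>
    let ⟨_, _, V, _, _, hVo, hmV, hV, hπV⟩ := h.exists_isSimplyConnected_nhds univ_mem
    ⟨V, hVo.mem_nhds hmV, hV, hπV⟩

theorem exists_eq_orbitPi1 [IsTopologicalGroup G] {e : Bundle.Trivialization G π}
    (he : IsEquivariantTrivialization e) {V : Set M} (hVe : V ⊆ e.baseSet)
    (hV : IsSimplyConnected V) {y : P} (p : Path y y) (hp : ∀ t, π (p t) ∈ V) :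
    ∃ b : FundamentalGroup G 1, Path.Homotopic.Quotient.mk p = (h.orbitPi1 y b).toPath := by
  have := hV.simplyConnectedSpace
  have hy : π y ∈ V := p.source ▸ hp 0
  let l : Path (1 : G) 1 :=
    { toFun t := (e y).2⁻¹ * (e (p t)).2
      continuous_toFun := continuous_const.mul <| continuous_snd.comp <|
        e.continuousOn_toFun.comp_continuous p.continuous fun t => e.mem_source.2 (hVe (hp t))
      source' := by simp
      target' := by simp }
  let p₁ : Path (⟨π y, hy⟩ : V) ⟨π y, hy⟩ :=
    { toFun t := ⟨π (p t), hp t⟩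
      continuous_toFun := (h.smooth_proj.continuous.comp p.continuous).subtype_mk _
      source' := by simp
      target' := by simp }
  let s : C(V, P) :=
    ⟨fun m => e.toOpenPartialHomeomorph.symm (m, (e y).2),
      e.toOpenPartialHomeomorph.continuousOn_symm.comp_continuous (by fun_prop) fun m =>
        e.mem_target.2 (hVe m.2)⟩
  have hs : s ⟨π y, hy⟩ = y := e.symm_apply_mk_proj (e.mem_source.2 (hVe hy))
  have hp_eq : p = h.smulPath ((p₁.map s.continuous).cast hs.symm hs.symm) l := by
    ext t
    change p t = MulOpposite.op ((e y).2⁻¹ * (e (p t)).2) •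
      e.toOpenPartialHomeomorph.symm (π (p t), (e y).2)
    rw [← he.symm_mul (hVe (hp t)), mul_inv_cancel_left]
    exact (e.symm_apply_mk_proj (e.mem_source.2 (hVe (hp t)))).symm
  have hp₁ : Path.Homotopic.Quotient.mk ((p₁.map s.continuous).cast hs.symm hs.symm) = .refl y :=
    (Path.Homotopic.Quotient.eq.2 (((SimplyConnectedSpace.paths_homotopic p₁ (.refl _)).map
      s).pathCast hs.symm hs.symm)).trans
      (congrArg Path.Homotopic.Quotient.mk (Path.ext (funext fun _ => hs)))
  refine ⟨FundamentalGroup.fromPath (.mk l), ?_⟩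
  rw [hp_eq, (h.mk_smulPath _ l).1, hp₁, Path.Homotopic.Quotient.refl_trans]

theorem mem_range_orbitPi1 [IsTopologicalGroup G] [ConnectedSpace M] [ConnectedSpace G] {p : P}
    {a : FundamentalGroup P p} (ha : h.projPi1 p a = 1) : a ∈ (h.orbitPi1 p).range := by
  have := h.pathConnectedSpace
  have := h.normal_range_orbitPi1 p
  obtain ⟨E, _, q, cov, mk, hmk⟩ := exists_isCoveringMap_monodromy_eq (f := h.projMap)
    h.surjective_proj (QuotientGroup.mk' (h.orbitPi1 p).range) fun m U hU => by
      obtain ⟨e, he, V, hVU, hVe, hVo, hmV, hV, hπV⟩ := h.exists_isSimplyConnected_nhds hU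
      refine ⟨V, hVU, hVo, hmV, hπV, fun y δ γ hδ => ?_⟩
      obtain ⟨b, hb⟩ := h.exists_eq_orbitPi1 he hVe hV δ hδ
      rw [hb, ← Path.Homotopic.Quotient.trans_assoc, h.trans_orbitPi1,
        Path.Homotopic.Quotient.trans_assoc, Path.Homotopic.Quotient.trans_symm,
        Path.Homotopic.Quotient.trans_refl]
      exact (QuotientGroup.eq_one_iff _).2 ⟨b, rfl⟩
  have hmon := hmk a 1
  rw [show FundamentalGroup.map h.projMap p a = .refl _ from ha, cov.monodromy_refl, id,
    mul_one] at hmon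
  exact (QuotientGroup.eq_one_iff a).1 ((mk p).injective hmon).symm

theorem range_orbitPi1 [IsTopologicalGroup G] [ConnectedSpace M] [ConnectedSpace G] (p : P) :
    (h.orbitPi1 p).range = (h.projPi1 p).ker :=
  le_antisymm (by rintro _ ⟨b, rfl⟩; exact h.projPi1_orbitPi1 p b) fun _ => h.mem_range_orbitPi1

end IsPrincipalBundle

section Splitting

variable {H Γ B : Type*} [Group H] [Group Γ] [Group B] {i : H →* Γ} {π : Γ →* B}

theorem IsInternalDirectProduct.exists_leftInverse {K L : Subgroup Γ}
    (h : IsInternalDirectProduct K L) (hi : BijOn i univ L) :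
    ∃ r : Γ →* H, Function.LeftInverse r i := by
  have hcomm (x : K) (y : L) : Commute (K.subtype x) (L.subtype y) := h.commute x x.2 y y.2
  let mul : K × L ≃* Γ := MulEquiv.ofBijective (K.subtype.noncommCoprod L.subtype hcomm)
    ⟨(MonoidHom.noncommCoprod_injective _ _ hcomm).2 ⟨K.subtype_injective, L.subtype_injective, by
        rw [K.range_subtype, L.range_subtype, disjoint_iff, h.inf_eq_bot]⟩,
      MonoidHom.range_eq_top.1 <| by
        rw [MonoidHom.noncommCoprod_range, K.range_subtype, L.range_subtype, h.sup_eq_top]⟩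
  let iL : H ≃* L := MulEquiv.ofBijective (i.codRestrict L fun b => hi.mapsTo (mem_univ b))
    ⟨fun _ _ hb => hi.injOn (mem_univ _) (mem_univ _) (congrArg Subtype.val hb), fun y =>
      let ⟨b, _, hb⟩ := hi.surjOn y.2; ⟨b, Subtype.ext hb⟩⟩
  refine ⟨(iL.symm : L →* H).comp ((MonoidHom.snd K L).comp mul.symm), fun b => ?_⟩
  have hib : mul (1, iL b) = i b := one_mul (i b)
  change iL.symm (mul.symm (i b)).2 = b
  rw [← hib, mul.symm_apply_apply, iL.symm_apply_apply]

variable {r : Γ →* H} (hr : Function.LeftInverse r i)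
include hr

theorem isInternalDirectProduct_ker_range (hi : ∀ a b, Commute a (i b)) :
    IsInternalDirectProduct r.ker i.range where
  commute := by
    rintro a - _ ⟨b, rfl⟩
    exact hi a b
  inf_eq_bot := by
    refine (Subgroup.eq_bot_iff_forall _).2 ?_
    rintro _ ⟨hb, b, rfl⟩
    rw [← hr b, show r (i b) = 1 from hb, map_one]
  sup_eq_top := (Subgroup.eq_top_iff' _).2 fun a => by
    rw [← inv_mul_cancel_right a (i (r a)), ← map_inv]
    refine Subgroup.mul_mem_sup ?_ ⟨r a, rfl⟩
    rw [MonoidHom.mem_ker, map_mul, hr, mul_inv_cancel]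

theorem bijOn_ker_of_leftInverse (hexact : i.range = π.ker) (hπ : Function.Surjective π) :
    BijOn π r.ker univ := by
  refine ⟨mapsTo_univ _ _, fun a ha a' ha' haa' => ?_, fun b _ => ?_⟩
  · obtain ⟨c, hc⟩ : a⁻¹ * a' ∈ i.range := by
      rw [hexact, MonoidHom.mem_ker, map_mul, map_inv, haa', inv_mul_cancel]
    have hc_one : c = 1 := by
      rw [← hr c, hc, map_mul, map_inv, show r a = 1 from ha, show r a' = 1 from ha', inv_one,
        one_mul]
    rw [hc_one, map_one] at hc
    exact inv_mul_eq_one.1 hc.symm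
  · obtain ⟨a, rfl⟩ := hπ b
    refine ⟨a * i (r a)⁻¹, ?_, ?_⟩
    · rw [SetLike.mem_coe, MonoidHom.mem_ker, map_mul, hr, mul_inv_cancel]
    · rw [map_mul, show π (i (r a)⁻¹) = 1 from hexact.le ⟨_, rfl⟩, mul_one]

omit hr in
theorem exists_isInternalDirectProduct_iff (hi : ∀ a b, Commute a (i b))
    (hexact : i.range = π.ker) (hπ : Function.Surjective π) :
    (∃ K L : Subgroup Γ, IsInternalDirectProduct K L ∧ BijOn π K univ ∧ BijOn i univ L) ↔
      ∃ r : Γ →* H, Function.LeftInverse r i := by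
  constructor
  · rintro ⟨K, L, hKL, -, hL⟩
    exact hKL.exists_leftInverse hL
  · rintro ⟨r, hr⟩
    refine ⟨r.ker, i.range, isInternalDirectProduct_ker_range hr hi,
      bijOn_ker_of_leftInverse hr hexact hπ, ?_⟩
    rw [MonoidHom.coe_range, ← image_univ]
    exact hr.injective.injOn.bijOn_image

end Splitting

theorem IsEquivariantTrivialization.inv_mul_smul {M G P : Type*} [TopologicalSpace M]
    [TopologicalSpace G] [TopologicalSpace P] [Group G] [MulAction Gᵐᵒᵖ P] {π : P → M}
    {e : Bundle.Trivialization G π} (he : IsEquivariantTrivialization e) {p p' : P}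
    (hp : π p ∈ e.baseSet) (hpp' : π p = π p') :
    MulOpposite.op ((e p).2⁻¹ * (e p').2) • p = p' :=
  calc MulOpposite.op ((e p).2⁻¹ * (e p').2) • p
      = MulOpposite.op ((e p).2⁻¹ * (e p').2) • e.toOpenPartialHomeomorph.symm (π p, (e p).2) := by
        rw [e.symm_apply_mk_proj (e.mem_source.2 hp)]
    _ = e.toOpenPartialHomeomorph.symm (π p', (e p').2) := by
        rw [← he.symm_mul hp, mul_inv_cancel_left, hpp']
    _ = p' := e.symm_apply_mk_proj (e.mem_source.2 (hpp' ▸ hp))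

theorem continuousAt_trivialization_snd {B F Z : Type*} [TopologicalSpace B] [TopologicalSpace F]
    [TopologicalSpace Z] {π : Z → B} (e : Bundle.Trivialization F π) {z : Z}
    (hz : π z ∈ e.baseSet) : ContinuousAt (fun z => (e z).2) z :=
  continuousAt_snd.comp (e.toOpenPartialHomeomorph.continuousAt (e.mem_source.2 hz))

namespace IsUniversalCoveringGroup

variable {k : ℕ} {G : Type uG} [Group G] [TopologicalSpace G]
  [ChartedSpace (EuclideanSpace ℝ (Fin k)) G] {G' : Type uGt} [Group G'] [TopologicalSpace G']
  [ChartedSpace (EuclideanSpace ℝ (Fin k)) G'] {ρ : G' →* G} (hρ : IsUniversalCoveringGroup k ρ)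
include hρ

theorem surjective [IsTopologicalGroup G] [ConnectedSpace G] : Function.Surjective ρ := by
  have hopen : IsOpen (ρ.range : Set G) :=
    ρ.coe_range ▸ hρ.isCoveringMap.isOpenMap.isOpen_range
  exact range_eq_univ.1 (ρ.coe_range ▸
    IsClopen.eq_univ ⟨ρ.range.isClosed_of_isOpen hopen, hopen⟩ ⟨1, ρ.range.one_mem⟩)

theorem isDiscrete_ker : IsDiscrete (ρ.ker : Set G') :=
  ⟨(hρ.isCoveringMap 1).discreteTopology_fiber⟩

theorem isQuotientCoveringMap [IsTopologicalGroup G] [ConnectedSpace G] [IsTopologicalGroup G'] :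
    IsQuotientCoveringMap ρ ρ.ker.op :=
  (hρ.isCoveringMap.isQuotientMap hρ.surjective).isQuotientCoveringMap_of_subgroupOp ρ.ker
    hρ.isDiscrete_ker (fun {_ _} => by rw [MonoidHom.mem_ker, map_mul, map_inv, inv_mul_eq_one])

end IsUniversalCoveringGroup

namespace IsPrincipalBundle

theorem exists_mem_nhds_forall_smul_mem {n k d : ℕ} {M : Type uM} [TopologicalSpace M]
    [ChartedSpace (EuclideanSpace ℝ (Fin n)) M] {G : Type uG} [Group G] [TopologicalSpace G]
    [ChartedSpace (EuclideanSpace ℝ (Fin k)) G] [IsTopologicalGroup G] {P : Type uP}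
    [TopologicalSpace P] [ChartedSpace (EuclideanSpace ℝ (Fin d)) P] [MulAction Gᵐᵒᵖ P] {π : P → M}
    (h : IsPrincipalBundle n k d G π) {S : Subgroup G} (hS : IsDiscrete (S : Set G)) (p : P) :
    ∃ U ∈ 𝓝 p, ∀ g ∈ S, ∀ p' ∈ U, MulOpposite.op g • p' ∈ U → g = 1 := by
  obtain ⟨e, hp, he⟩ := h.exists_isEquivariantTrivialization (π p)
  have hdiv : Tendsto (fun x : P × P => (e x.1).2⁻¹ * (e x.2).2) (𝓝 p ×ˢ 𝓝 p) (𝓝 1) := by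
    have he_cont := continuousAt_trivialization_snd e hp
    simpa using (he_cont.tendsto.comp tendsto_fst).inv.mul (he_cont.tendsto.comp tendsto_snd)
  have hone : ∀ᶠ g in 𝓝 (1 : G), g ∈ S → g = 1 :=
    eventually_nhdsWithin_iff.1 ((hS.nhdsWithin 1 S.one_mem).symm ▸ eventually_pure.2 rfl)
  obtain ⟨U, hU, hUS⟩ := eventually_prod_self_iff'.1 (hdiv.eventually hone)
  refine ⟨U ∩ π ⁻¹' e.baseSet, inter_mem hU (h.smooth_proj.continuous.continuousAt.preimage_mem_nhds
    (e.open_baseSet.mem_nhds hp)), fun g hg p' hp' hgp' => ?_⟩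
  have hmul := hUS _ hp'.1 _ hgp'.1
  rw [he.apply_smul hp'.2, inv_mul_cancel_left] at hmul
  exact hmul hg

section EquivariantMaps

variable {n k k' d d' : ℕ} {M : Type uM} [TopologicalSpace M]
  [ChartedSpace (EuclideanSpace ℝ (Fin n)) M] {G : Type uG} [Group G] [TopologicalSpace G]
  [ChartedSpace (EuclideanSpace ℝ (Fin k)) G] {G' : Type uGt} [Group G'] [TopologicalSpace G']
  {P : Type uP} [TopologicalSpace P] [ChartedSpace (EuclideanSpace ℝ (Fin d)) P] [MulAction Gᵐᵒᵖ P]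
  {πP : P → M} (hP : IsPrincipalBundle n k d G πP) {Q : Type*} [TopologicalSpace Q]
  [MulAction G'ᵐᵒᵖ Q] {ρ : G' →* G} {u : Q → P}
  (hequiv : ∀ (q : Q) (g : G'), u (MulOpposite.op g • q) = MulOpposite.op (ρ g) • u q)
include hP hequiv

theorem monodromy_orbitPi1 (hρ : IsCoveringMap ρ) (cov : IsCoveringMap u) {p : P}
    (q : u ⁻¹' {p}) (hq : Continuous fun g : G' => MulOpposite.op g • (q : Q))
    (b : FundamentalGroup G 1) :
    (cov.monodromy (hP.orbitPi1 p b).toPath q : Q) =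
      MulOpposite.op (hρ.monodromy b.toPath ⟨1, map_one ρ⟩ : G') • (q : Q) := by
  obtain ⟨l, rfl⟩ := Path.Homotopic.Quotient.mk_surjective b
  obtain ⟨q, rfl⟩ := q
  let l' := hρ.liftPath l 1 (l.source.trans (map_one ρ).symm)
  have hlift (t : unitInterval) : ρ (l' t) = l t := congrFun (hρ.liftPath_lifts ..) t
  have hend : u (MulOpposite.op (l' 1) • q) = u q := by
    rw [hequiv, hlift, l.target, MulOpposite.op_one, one_smul]
  let γ : Path q (MulOpposite.op (l' 1) • q) :=
    { toFun t := MulOpposite.op (l' t) • q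
      continuous_toFun := hq.comp l'.continuous
      source' := by rw [hρ.liftPath_zero, MulOpposite.op_one, one_smul]
      target' := rfl }
  refine congrArg Subtype.val
    (cov.monodromy_eq_of_map_eq (ex := ⟨q, rfl⟩) (ey := ⟨_, hend⟩) (.mk γ) ?_)
  refine Eq.trans ?_ (congrArg (Path.Homotopic.Quotient.cast · rfl hend)
    (hP.orbitPi1_mk (u q) l).symm)
  refine congrArg Path.Homotopic.Quotient.mk (Path.ext (funext fun t => ?_))
  change u (MulOpposite.op (l' t) • q) = MulOpposite.op (l t) • u q
  rw [hequiv, hlift]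

variable [ChartedSpace (EuclideanSpace ℝ (Fin k')) G'] [ChartedSpace (EuclideanSpace ℝ (Fin d')) Q]
  {πQ : Q → M} (hQ : IsPrincipalBundle n k' d' G' πQ) (hproj : ∀ q, πP (u q) = πQ q)
include hQ hproj

theorem isOpenMap_of_equivariant [IsTopologicalGroup G] (hρ : IsOpenMap ρ) (hu : Continuous u) :
    IsOpenMap u := by
  refine isOpenMap_iff_nhds_le.2 fun q U hU => ?_
  obtain ⟨eP, hmP, heP⟩ := hP.exists_isEquivariantTrivialization (πP (u q))
  obtain ⟨eQ, hmQ, -⟩ := hQ.exists_isEquivariantTrivialization (πP (u q))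
  have hπP := hP.smooth_proj.continuous.continuousAt (x := u q)
  let s (p : P) : Q := eQ.toOpenPartialHomeomorph.symm (πP p, (eQ q).2)
  have hs : Tendsto s (𝓝 (u q)) (𝓝 q) := by
    have hsq : s (u q) = q := by
      rw [hproj] at hmQ
      simp only [s, hproj]
      exact eQ.symm_apply_mk_proj (eQ.mem_source.2 hmQ)
    have : ContinuousAt s (u q) := (eQ.continuousAt_symm_prodMk_left hmQ).comp hπP
    rwa [ContinuousAt, hsq] at this
  have hdiv : Tendsto (fun p => (eP (u (s p))).2⁻¹ * (eP p).2) (𝓝 (u q)) (𝓝 1) := by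
    have heP_cont := (continuousAt_trivialization_snd eP hmP).tendsto
    simpa using (heP_cont.comp ((hu.tendsto q).comp hs)).inv.mul heP_cont
  have hsmul : ∀ᶠ x in 𝓝 q ×ˢ map ρ (𝓝 1), MulOpposite.op x.2 • u x.1 ∈ U := by
    have htendsto : Tendsto (fun x : Q × G' => u (MulOpposite.op x.2 • x.1)) (𝓝 q ×ˢ 𝓝 1)
        (map u (𝓝 q)) := by
      have := hQ.continuous_smul.tendsto (q, 1)
      rw [nhds_prod_eq, MulOpposite.op_one, one_smul] at this
      exact tendsto_map.comp this
    rw [← map_id (f := 𝓝 q), prod_map_map_eq, eventually_map]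
    filter_upwards [htendsto.eventually hU] with x hx using hequiv x.1 x.2 ▸ hx
  have hρ_one : 𝓝 1 ≤ map ρ (𝓝 1) := map_one ρ ▸ hρ.nhds_le 1
  filter_upwards [(hs.prodMk (hdiv.mono_right hρ_one)).eventually hsmul,
    hπP.preimage_mem_nhds (eP.open_baseSet.mem_nhds hmP),
    hπP.preimage_mem_nhds (eQ.open_baseSet.mem_nhds hmQ)] with p hp hpP hpQ
  have hπs : πP (u (s p)) = πP p := (hproj _).trans (eQ.proj_symm_apply' hpQ)
  rwa [heP.inv_mul_smul (hπs ▸ hpP) hπs] at hp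

theorem surjective_of_equivariant (hρ : Function.Surjective ρ) : Function.Surjective u := by
  intro p
  obtain ⟨q, hq⟩ := hQ.surjective_proj (πP p)
  obtain ⟨g, hg⟩ := hP.transitive (u q) p (by rw [hproj, hq])
  obtain ⟨g', rfl⟩ := hρ g
  exact ⟨MulOpposite.op g' • q, by rw [hequiv, hg]⟩

theorem isQuotientCoveringMap_of_equivariant [IsTopologicalGroup G] [IsTopologicalGroup G']
    (hρ : IsOpenMap ρ) (hρs : Function.Surjective ρ) (hρk : IsDiscrete (ρ.ker : Set G'))
    (hu : Continuous u) : IsQuotientCoveringMap u ρ.ker.op where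
  toIsQuotientMap := (hP.isOpenMap_of_equivariant hequiv hQ hproj hρ hu).isQuotientMap hu
    (hP.surjective_of_equivariant hequiv hQ hproj hρs)
  continuous_const_smul c :=
    hQ.continuous_smul.comp (f := fun q => (q, MulOpposite.unop c.1)) (by fun_prop)
  apply_eq_iff_mem_orbit := @fun q₁ q₂ => by
    constructor
    · intro hq
      obtain ⟨g, rfl⟩ := hQ.transitive q₂ q₁ (by rw [← hproj, ← hproj, hq])
      exact ⟨⟨MulOpposite.op g, hP.free _ _ ((hequiv q₂ g).symm.trans hq)⟩, rfl⟩
    · rintro ⟨⟨⟨g⟩, hg⟩, rfl⟩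
      exact (hequiv q₂ g).trans (by rw [show ρ g = 1 from hg, MulOpposite.op_one, one_smul])
  disjoint q := by
    obtain ⟨U, hU, hU_one⟩ := hQ.exists_mem_nhds_forall_smul_mem hρk q
    refine ⟨U, hU, ?_⟩
    rintro ⟨⟨g⟩, hg⟩ ⟨_, ⟨q', hq', rfl⟩, hgq'⟩
    obtain rfl := hU_one g hg q' hq' hgq'
    rfl

end EquivariantMaps

end IsPrincipalBundle

theorem SpinorStructure.exists_leftInverse_orbitPi1 {n k d : ℕ} {M : Type uM} [TopologicalSpace M]
    [ChartedSpace (EuclideanSpace ℝ (Fin n)) M] {G : Type uG} [Group G] [TopologicalSpace G]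
    [ChartedSpace (EuclideanSpace ℝ (Fin k)) G] [IsTopologicalGroup G] [ConnectedSpace G]
    {G' : Type uGt} [Group G'] [TopologicalSpace G'] [ChartedSpace (EuclideanSpace ℝ (Fin k)) G']
    [IsTopologicalGroup G'] {ρ : G' →* G} (hρ : IsUniversalCoveringGroup k ρ) {P : Type uP}
    [TopologicalSpace P] [ChartedSpace (EuclideanSpace ℝ (Fin d)) P] [MulAction Gᵐᵒᵖ P] {πP : P → M}
    (hP : IsPrincipalBundle n k d G πP) (p₀ : P) (S : SpinorStructure n k d ρ πP) :
    ∃ r : FundamentalGroup P p₀ →* FundamentalGroup G (1 : G),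
      Function.LeftInverse r (hP.orbitPi1 p₀) := by
  let := S.topologicalSpace
  let := S.chartedSpace
  let := S.mulAction
  have := hρ.simplyConnected
  have hρq := hρ.isQuotientCoveringMap
  have huq : IsQuotientCoveringMap S.u ρ.ker.op :=
    hP.isQuotientCoveringMap_of_equivariant S.equivariant_u S.isPrincipalBundle S.proj_u
      hρ.isCoveringMap.isOpenMap hρ.surjective hρ.isDiscrete_ker S.smooth_u.continuous
  obtain ⟨q₀, hq₀⟩ := huq.surjective p₀
  let deckρ : FundamentalGroup G 1 ≃* ρ.ker.opᵐᵒᵖ := hρq.fundamentalGroupEquiv ⟨1, map_one ρ⟩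
  let deck_u : FundamentalGroup P p₀ →* ρ.ker.opᵐᵒᵖ := huq.fundamentalGroupToMulOpposite ⟨q₀, hq₀⟩
  refine ⟨(deckρ.symm : _ →* _).comp deck_u, fun b => deckρ.symm_apply_eq.2 ?_⟩
  have hb : (deckρ b).unop • (1 : G') = hρq.isCoveringMap.monodromy b.toPath ⟨1, map_one ρ⟩ :=
    hρq.unop_fundamentalGroupToMulOpposite_smul
  refine huq.fundamentalGroupToMulOpposite_apply_eq_Iff.2 ?_
  have hcont : Continuous fun g : G' => MulOpposite.op g • q₀ :=
    S.isPrincipalBundle.continuous_smul.comp (.prodMk_right q₀)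
  refine Eq.trans ?_ (hP.monodromy_orbitPi1 S.equivariant_u hρq.isCoveringMap
    huq.isCoveringMap ⟨q₀, hq₀⟩ hcont b).symm
  rw [← hb]
  exact congrArg (fun g : G'ᵐᵒᵖ => g • q₀) (MulOpposite.unop_injective (one_mul _).symm)

section LiftedActions

variable {X Y P Q : Type*} [TopologicalSpace X] [TopologicalSpace Y] [TopologicalSpace P]
  [TopologicalSpace Q] {u : Q → P}

theorem continuous_lift_apply_of_pathConnectedSpace [PathConnectedSpace Y] (cov : IsCoveringMap u)
    {s : X → Y → Q} (hus : Continuous fun x : X × Y => u (s x.1 x.2)) (hs : ∀ x, Continuous (s x))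
    {y₀ : Y} (hs₀ : Continuous fun x => s x y₀) (y : Y) : Continuous fun x => s x y := by
  let γ : Path y₀ y := PathConnectedSpace.somePath y₀ y
  have h := cov.isLocalHomeomorph.continuous_lift cov.isSeparatedMap
    (f := ⟨fun x : unitInterval × X => u (s x.2 (γ x.1)),
      hus.comp (continuous_snd.prodMk (γ.continuous.comp continuous_fst))⟩)
    (g := fun x => s x.2 (γ x.1)) rfl (by simpa only [γ.source] using hs₀)
    (fun x => (hs x).comp γ.continuous)
  simpa only [Function.comp_def, γ.target] using h.comp (Continuous.prodMk_right (1 : unitInterval))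

theorem continuous_uncurry_lift [PathConnectedSpace Y] [LocallyPathConnectedSpace Y]
    (cov : IsCoveringMap u) {s : X → Y → Q} (hus : Continuous fun x : X × Y => u (s x.1 x.2))
    (hs : ∀ x, Continuous (s x)) {y₀ : Y} (hs₀ : Continuous fun x => s x y₀) :
    Continuous fun x : X × Y => s x.1 x.2 := by
  refine continuous_iff_continuousAt.2 fun ⟨x₁, y₁⟩ => ?_
  obtain ⟨f, hf, rfl⟩ := cov.isLocalHomeomorph (s x₁ y₁)
  obtain ⟨W, hW, N, hN, hWN⟩ := mem_nhds_prod_iff.1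
    ((f.open_target.preimage hus).mem_nhds (f.map_source hf))
  obtain ⟨N', ⟨hN', hN'c⟩, hN'N⟩ := (path_connected_basis y₁).mem_iff.1 hN
  have hs_y₁ : Continuous fun x => s x y₁ :=
    continuous_lift_apply_of_pathConnectedSpace cov hus hs hs₀ y₁
  have hW' : {x | s x y₁ ∈ f.source} ∈ 𝓝 x₁ := (f.open_source.preimage hs_y₁).mem_nhds hf
  have hlocal : ∀ᶠ x in 𝓝 (x₁, y₁), f.symm (f (s x.1 x.2)) = s x.1 x.2 := by
    filter_upwards [prod_mem_nhds (inter_mem hW hW') hN'] with ⟨x, y⟩ ⟨⟨hxW, hxs⟩, hy⟩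
    have hmem : MapsTo (fun y => f (s x y)) N' f.target := fun z hz => @hWN (x, z) ⟨hxW, hN'N hz⟩
    exact cov.eqOn_of_comp_eqOn (g₁ := fun y => f.symm (f (s x y))) (g₂ := s x)
      hN'c.isConnected.isPreconnected
      (f.continuousOn_symm.comp (hus.comp (Continuous.prodMk_right x)).continuousOn hmem)
      (hs x).continuousOn (fun y hy => f.right_inv (hmem hy)) (mem_of_mem_nhds hN')
      (f.left_inv hxs) hy
  exact ((f.continuousAt_symm (f.map_source hf)).comp (f := fun x : X × Y => f (s x.1 x.2))
    hus.continuousAt).congr hlocal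

theorem exists_mulAction_lift {H : Type*} [Group H] [TopologicalSpace H] [ContinuousMul H]
    [SimplyConnectedSpace H] [LocallyPathConnectedSpace H] [MulAction H P] [ContinuousSMul H P]
    (cov : IsCoveringMap u) :
    ∃ _ : MulAction H Q, ContinuousSMul H Q ∧ ∀ (h : H) (q : Q), u (h • q) = h • u q := by
  have hlift (q : Q) : ∃ F : C(H, Q), F 1 = q ∧ ∀ h, u (F h) = h • u q :=
    let ⟨F, ⟨hF_one, hF⟩, _⟩ := cov.existsUnique_continuousMap_lifts
      (⟨fun h => h • u q, by fun_prop⟩ : C(H, P)) 1 q (one_smul H _).symm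
    ⟨F, hF_one, congrFun hF⟩
  choose s hs_one hus using hlift
  have hs_mul (h h' : H) (q : Q) : s q (h * h') = s (s q h') h := by
    refine congrFun (cov.eq_of_comp_eq (g₁ := fun h => s q (h * h'))
      ((s q).continuous.comp (continuous_mul_const h')) (s (s q h')).continuous ?_ 1 ?_) h
    · funext h
      simp only [Function.comp_apply, hus, mul_smul]
    · rw [one_mul, hs_one]
  have hs : Continuous fun x : Q × H => s x.1 x.2 :=
    continuous_uncurry_lift (s := fun q => s q) cov
      (by simp only [hus]; exact continuous_snd.smul (cov.continuous.comp continuous_fst))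
      (fun q => (s q).continuous) (y₀ := 1) (by simpa only [hs_one] using continuous_id')
  let action : MulAction H Q :=
    { smul := fun h q => s q h
      one_smul := hs_one
      mul_smul := hs_mul }
  exact ⟨action, ⟨hs.comp continuous_swap⟩, fun h q => hus q h⟩

end LiftedActions

section LocalHomeomorphisms

variable {X Y : Type*} [TopologicalSpace X] [TopologicalSpace Y] {f : X → Y}

theorem exists_openPartialHomeomorph_of_injOn [Nonempty X] {s : Set X}
    (hf : IsLocalHomeomorphOn f s) (hs : IsOpen s) (hinj : InjOn f s) :
    ∃ Φ : OpenPartialHomeomorph X Y, Φ.source = s ∧ Φ.target = f '' s ∧ ⇑Φ = f := by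
  have hopen : IsOpenMap (s.domRestrict f) := isOpenMap_iff_nhds_le.2 fun x => by
    rw [show s.domRestrict f = f ∘ Subtype.val from rfl, ← map_map,
      hs.isOpenEmbedding_subtypeVal.map_nhds_eq x, hf.map_nhds_eq x.2, Function.comp_apply]
  exact ⟨.ofContinuousOpenRestrict (hinj.toPartialEquiv f s) hf.continuousOn hopen hs, rfl, rfl,
    rfl⟩

theorem exists_continuousOn_lift {Z : Type*} [TopologicalSpace Z] (hf : IsLocalHomeomorph f)
    {s : Set Z} (hs : IsOpen s) {g : Z → Y} (hg : ContinuousOn g s) {z : Z} (hz : z ∈ s) {x : X}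
    (hx : f x = g z) :
    ∃ U ⊆ s, IsOpen U ∧ z ∈ U ∧ ∃ τ : Z → X, ContinuousOn τ U ∧ ∀ y ∈ U, f (τ y) = g y := by
  obtain ⟨φ, hφ, rfl⟩ := hf x
  exact ⟨s ∩ g ⁻¹' φ.target, inter_subset_left, hg.isOpen_inter_preimage hs φ.open_target,
    ⟨hz, mem_preimage.2 (hx ▸ φ.map_source hφ)⟩, fun y => φ.symm (g y),
    φ.continuousOn_symm.comp (hg.mono inter_subset_left) fun y hy => hy.2,
    fun y hy => φ.right_inv hy.2⟩

end LocalHomeomorphisms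

theorem exists_trivialization_of_isLocalHomeomorphOn_smul {M G Q : Type*} [TopologicalSpace M]
    [Nonempty M] [Group G] [TopologicalSpace G] [TopologicalSpace Q] [MulAction Gᵐᵒᵖ Q] {π : Q → M}
    (hfree : ∀ (q : Q) (g : G), MulOpposite.op g • q = q → g = 1)
    (htrans : ∀ q q' : Q, π q = π q' → ∃ g : G, MulOpposite.op g • q = q')
    {U : Set M} (hU : IsOpen U) {τ : M → Q}
    (hτ : IsLocalHomeomorphOn (fun x : M × G => MulOpposite.op x.2 • τ x.1) (U ×ˢ univ))
    (hπτ : ∀ m ∈ U, ∀ g : G, π (MulOpposite.op g • τ m) = m) :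
    ∃ e : Bundle.Trivialization G π, e.baseSet = U ∧
      ∀ x, e.toOpenPartialHomeomorph.symm x = MulOpposite.op x.2 • τ x.1 := by
  have hinj : InjOn (fun x : M × G => MulOpposite.op x.2 • τ x.1) (U ×ˢ univ) := by
    rintro ⟨m, g⟩ ⟨hm, -⟩ ⟨m', g'⟩ ⟨hm', -⟩ h
    obtain rfl : m = m' := (hπτ m hm g).symm.trans ((congrArg π h).trans (hπτ m' hm' g'))
    refine Prod.ext rfl (mul_inv_eq_one.1 (hfree (τ m) _ ?_))
    rw [MulOpposite.op_mul, mul_smul, MulOpposite.op_inv, inv_smul_eq_iff]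
    exact h
  obtain ⟨Φ, hΦs, hΦt, hΦ⟩ :=
    exists_openPartialHomeomorph_of_injOn hτ (hU.prod isOpen_univ) hinj
  refine ⟨{ Φ.symm with
    baseSet := U
    open_baseSet := hU
    source_eq := ?_
    target_eq := hΦs
    proj_toFun := fun q hq => ?_ }, rfl, congrFun hΦ⟩
  · refine hΦt.trans (Subset.antisymm ?_ fun q hq => ?_)
    · rintro _ ⟨⟨m, g⟩, ⟨hm, -⟩, rfl⟩
      exact mem_preimage.2 ((hπτ m hm g).symm ▸ hm)
    · obtain ⟨g, hg⟩ := htrans (τ (π q)) q (by simpa using hπτ (π q) hq 1)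
      exact ⟨(π q, g), ⟨hq, mem_univ g⟩, hg⟩
  · have hx : Φ.symm q ∈ U ×ˢ (univ : Set G) := hΦs ▸ Φ.map_target hq
    calc (Φ.symm q).1 = π (Φ (Φ.symm q)) := by rw [hΦ]; exact (hπτ _ hx.1 _).symm
      _ = π q := by rw [Φ.right_inv hq]

namespace IsEquivariantTrivialization

variable {M G P : Type*} [TopologicalSpace M] [Group G] [TopologicalSpace G] [TopologicalSpace P]
  [MulAction Gᵐᵒᵖ P] {π : P → M} {e : Bundle.Trivialization G π}
  {G' Q : Type*} [Group G'] [TopologicalSpace G'] [TopologicalSpace Q] [MulAction G'ᵐᵒᵖ Q]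
  {ρ : G' →* G} {u : Q → P}

theorem isLocalHomeomorphOn_smul_section (he : IsEquivariantTrivialization e)
    (hu : IsLocalHomeomorph u) (hρ : IsLocalHomeomorph ρ)
    (hsmul : Continuous fun x : Q × G' => MulOpposite.op x.2 • x.1)
    (hequiv : ∀ (q : Q) (g : G'), u (MulOpposite.op g • q) = MulOpposite.op (ρ g) • u q)
    {U : Set M} (hU : IsOpen U) (hUe : U ⊆ e.baseSet) {τ : M → Q} (hτ : ContinuousOn τ U)
    (huτ : ∀ m ∈ U, u (τ m) = e.toOpenPartialHomeomorph.symm (m, 1)) :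
    IsLocalHomeomorphOn (fun x : M × G' => MulOpposite.op x.2 • τ x.1) (U ×ˢ univ) := by
  refine .of_comp_left (g := u) (.mk _ _ fun x hx => ?_) hu.isLocalHomeomorphOn fun x hx => ?_
  · obtain ⟨f, hf, hρf⟩ := hρ x.2
    refine ⟨((OpenPartialHomeomorph.ofSet U hU).prod f).trans e.toOpenPartialHomeomorph.symm,
      ?_, fun y hy => ?_⟩
    · simpa [hf, e.target_eq] using ⟨hx.1, hUe hx.1⟩
    · have hy' : y.1 ∈ U := hy.1.1
      simp [hequiv, huτ y.1 hy', ← he y.1 (hUe hy'), ← hρf]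
  · exact hsmul.continuousAt.comp (f := fun x : M × G' => (τ x.1, x.2))
      (((hτ.continuousAt (hU.mem_nhds hx.1)).comp continuousAt_fst).prodMk continuousAt_snd)

theorem exists_lift (he : IsEquivariantTrivialization e) (hu : IsLocalHomeomorph u)
    (hρ : IsLocalHomeomorph ρ) (hsmul : Continuous fun x : Q × G' => MulOpposite.op x.2 • x.1)
    (hequiv : ∀ (q : Q) (g : G'), u (MulOpposite.op g • q) = MulOpposite.op (ρ g) • u q)
    (hfree : ∀ (q : Q) (g : G'), MulOpposite.op g • q = q → g = 1)
    (htrans : ∀ q q' : Q, π (u q) = π (u q') → ∃ g : G', MulOpposite.op g • q = q')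
    (hsurj : Function.Surjective u) {m : M} (hm : m ∈ e.baseSet) :
    ∃ e' : Bundle.Trivialization G' (π ∘ u), IsEquivariantTrivialization e' ∧ m ∈ e'.baseSet ∧
      e'.baseSet ⊆ e.baseSet ∧ ∀ x : M × G', x.1 ∈ e'.baseSet →
        u (e'.toOpenPartialHomeomorph.symm x) = e.toOpenPartialHomeomorph.symm (x.1, ρ x.2) := by
  have : Nonempty M := ⟨m⟩
  have hσ : ContinuousOn (fun m => e.toOpenPartialHomeomorph.symm (m, 1)) e.baseSet :=
    e.toOpenPartialHomeomorph.continuousOn_symm.comp (Continuous.prodMk_left 1).continuousOn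
      fun m hm => e.mem_target.2 hm
  obtain ⟨q, hq⟩ := hsurj (e.toOpenPartialHomeomorph.symm (m, 1))
  obtain ⟨U, hUe, hU, hmU, τ, hτ, huτ⟩ := exists_continuousOn_lift hu e.open_baseSet hσ hm hq
  have hu_smul (x : M × G') (hx : x.1 ∈ U) :
      u (MulOpposite.op x.2 • τ x.1) = e.toOpenPartialHomeomorph.symm (x.1, ρ x.2) := by
    rw [hequiv, huτ _ hx, ← he _ (hUe hx)]
  obtain ⟨e', rfl, he'⟩ := exists_trivialization_of_isLocalHomeomorphOn_smul (π := π ∘ u) hfree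
    htrans hU (he.isLocalHomeomorphOn_smul_section hu hρ hsmul hequiv hU hUe hτ huτ) fun m hm g =>
      (congrArg π (hu_smul (m, g) hm)).trans (e.proj_symm_apply' (hUe hm))
  refine ⟨e', fun m _ g => ?_, hmU, hUe, fun x hx => by rw [he', hu_smul x hx]⟩
  rw [he', he', MulOpposite.op_one, one_smul]

end IsEquivariantTrivialization

namespace IsPrincipalBundle

variable {n k d : ℕ} {M : Type uM} [TopologicalSpace M] [ChartedSpace (EuclideanSpace ℝ (Fin n)) M]
  {G : Type uG} [Group G] [TopologicalSpace G] [ChartedSpace (EuclideanSpace ℝ (Fin k)) G]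
  {P : Type uP} [TopologicalSpace P] [ChartedSpace (EuclideanSpace ℝ (Fin d)) P]
  [MulAction Gᵐᵒᵖ P] {π : P → M} (h : IsPrincipalBundle n k d G π)
include h

theorem secondCountableTopology [SecondCountableTopology M] [SecondCountableTopology G] :
    SecondCountableTopology P := by
  choose e he _ using h.exists_isEquivariantTrivialization
  obtain ⟨c, hc, hcover⟩ := TopologicalSpace.countable_cover_nhds
    (fun m => (e m).open_baseSet.mem_nhds (he m))
  have := hc.to_subtype
  have (m : c) : SecondCountableTopology (e m).source :=
    (e m).toOpenPartialHomeomorph.toHomeomorphSourceTarget.secondCountableTopology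
  refine TopologicalSpace.secondCountableTopology_of_countable_cover
    (U := fun m : c => (e m).source) (fun m => (e m).open_source) (eq_univ_of_forall fun p => ?_)
  obtain ⟨m, hm, hpm⟩ := mem_iUnion₂.1 (hcover ▸ mem_univ (π p))
  exact mem_iUnion.2 ⟨⟨m, hm⟩, (e m).mem_source.2 hpm⟩

section LocalDiffeomorphisms

variable {G' : Type uGt} [Group G'] [TopologicalSpace G']
  [ChartedSpace (EuclideanSpace ℝ (Fin k)) G'] {Q : Type*} [TopologicalSpace Q]
  [ChartedSpace (EuclideanSpace ℝ (Fin d)) Q] [MulAction G'ᵐᵒᵖ Q] {ρ : G' →* G} {u : Q → P}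
  (hu : IsLocalDiffeomorph (𝓡 d) (𝓡 d) ∞ u) (hρ : IsLocalDiffeomorph (𝓡 k) (𝓡 k) ∞ ρ)
  (hsmul : Continuous fun x : Q × G' => MulOpposite.op x.2 • x.1)
  (hequiv : ∀ (q : Q) (g : G'), u (MulOpposite.op g • q) = MulOpposite.op (ρ g) • u q)
include hu hρ hsmul hequiv

theorem contMDiff_smul_of_isLocalDiffeomorph :
    ContMDiff ((𝓡 d).prod (𝓡 k)) (𝓡 d) ∞ fun x : Q × G' => MulOpposite.op x.2 • x.1 := by
  refine fun x => contMDiffAt_of_comp_isLocalDiffeomorphAt (hu _) hsmul.continuousAt ?_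
  have hsmooth : ContMDiff ((𝓡 d).prod (𝓡 k)) (𝓡 d) ∞
      fun x : Q × G' => MulOpposite.op (ρ x.2) • u x.1 :=
    h.smooth_action.comp ((hu.contMDiff.comp contMDiff_fst).prodMk
      (hρ.contMDiff.comp contMDiff_snd))
  exact (hsmooth x).congr_of_eventuallyEq (.of_forall fun x => hequiv x.1 x.2)

theorem exists_smooth_trivialization_comp
    (hfree : ∀ (q : Q) (g : G'), MulOpposite.op g • q = q → g = 1)
    (htrans : ∀ q q' : Q, π (u q) = π (u q') → ∃ g : G', MulOpposite.op g • q = q')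
    (hsurj : Function.Surjective u) (m : M) :
    ∃ e : Bundle.Trivialization G' (π ∘ u), m ∈ e.baseSet ∧
      ContMDiffOn (𝓡 d) ((𝓡 n).prod (𝓡 k)) ∞ e.toOpenPartialHomeomorph e.source ∧
      ContMDiffOn ((𝓡 n).prod (𝓡 k)) (𝓡 d) ∞ e.toOpenPartialHomeomorph.symm e.target ∧
      IsEquivariantTrivialization e := by
  obtain ⟨e, hm, he_smooth, he_symm, he⟩ := h.locally_trivial m
  obtain ⟨e', he', hm', hee', hsymm⟩ := IsEquivariantTrivialization.exists_lift he
    hu.isLocalHomeomorph hρ.isLocalHomeomorph hsmul hequiv hfree htrans hsurj hm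
  have hρ_snd (q : Q) (hq : q ∈ e'.source) : ρ (e' q).2 = (e (u q)).2 := by
    have hbase : (e' q).1 ∈ e'.baseSet := e'.mem_target.1 (e'.map_source hq)
    have huq : u q = e.toOpenPartialHomeomorph.symm ((e' q).1, ρ (e' q).2) :=
      (congrArg u (e'.left_inv hq)).symm.trans (hsymm _ hbase)
    rw [huq, e.apply_symm_apply' (hee' hbase)]
  refine ⟨e', hm', fun q hq => ?_, fun x hx => ?_, he'⟩
  · have hsource := e'.open_source.mem_nhds hq
    have heu : ContMDiffAt (𝓡 d) ((𝓡 n).prod (𝓡 k)) ∞ (fun q => e (u q)) q :=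
      (he_smooth.contMDiffAt (e.open_source.mem_nhds (e.mem_source.2
        (hee' (e'.mem_source.1 hq))))).comp q (hu.contMDiff q)
    have hfst : ContMDiffAt (𝓡 d) (𝓡 n) ∞ (fun q => (e' q).1) q :=
      (h.smooth_proj.comp hu.contMDiff q).congr_of_eventuallyEq
        (mem_of_superset hsource fun q hq => e'.coe_fst hq)
    have hsnd : ContMDiffAt (𝓡 d) (𝓡 k) ∞ (fun q => (e' q).2) q :=
      contMDiffAt_of_comp_isLocalDiffeomorphAt (hρ _)
        (continuousAt_trivialization_snd e' (e'.mem_source.1 hq))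
        (heu.snd.congr_of_eventuallyEq (mem_of_superset hsource hρ_snd))
    exact (hfst.prodMk hsnd).contMDiffWithinAt
  · have hbase := e'.mem_target.1 hx
    have hsmooth : ContMDiffAt ((𝓡 n).prod (𝓡 k)) (𝓡 d) ∞
        (fun x : M × G' => e.toOpenPartialHomeomorph.symm (x.1, ρ x.2)) x :=
      (he_symm.contMDiffAt (e.open_target.mem_nhds (e.mem_target.2 (hee' hbase)))).comp x
        (contMDiffAt_fst.prodMk ((hρ.contMDiff x.2).comp x contMDiffAt_snd))
    exact (contMDiffAt_of_comp_isLocalDiffeomorphAt (hu _)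
      (e'.toOpenPartialHomeomorph.continuousAt_symm hx)
      (hsmooth.congr_of_eventuallyEq (mem_of_superset (e'.open_target.mem_nhds hx)
        fun x hx => hsymm x (e'.mem_target.1 hx)))).contMDiffWithinAt

theorem comp_isLocalDiffeomorph
    (hfree : ∀ (q : Q) (g : G'), MulOpposite.op g • q = q → g = 1)
    (htrans : ∀ q q' : Q, π (u q) = π (u q') → ∃ g : G', MulOpposite.op g • q = q')
    (hsurj : Function.Surjective u) : IsPrincipalBundle n k d G' (π ∘ u) where
  smooth_proj := h.smooth_proj.comp hu.contMDiff
  surjective_proj := h.surjective_proj.comp hsurj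
  smooth_action := h.contMDiff_smul_of_isLocalDiffeomorph hu hρ hsmul hequiv
  proj_action q g := by rw [Function.comp_apply, hequiv, h.proj_action, Function.comp_apply]
  transitive := htrans
  free := hfree
  locally_trivial := h.exists_smooth_trivialization_comp hu hρ hsmul hequiv hfree htrans hsurj

end LocalDiffeomorphisms

end IsPrincipalBundle

theorem exists_monodromy_eq_of_map_eq_one {G G' : Type*} [Group G] [TopologicalSpace G] [Group G']
    [TopologicalSpace G'] [PathConnectedSpace G'] {ρ : G' →* G} (hρ : IsCoveringMap ρ) {g : G'}
    (hg : ρ g = 1) :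
    ∃ b : FundamentalGroup G 1, (hρ.monodromy b.toPath ⟨1, map_one ρ⟩ : G') = g := by
  let γ : Path.Homotopic.Quotient 1 g := .mk (PathConnectedSpace.somePath 1 g)
  let b : Path.Homotopic.Quotient (1 : G) 1 :=
    (γ.map ⟨ρ, hρ.continuous⟩).cast (map_one ρ).symm hg.symm
  refine ⟨.fromPath b, congrArg Subtype.val (hρ.monodromy_eq_of_map_eq (γ := b)
    (ex := ⟨1, map_one ρ⟩) (ey := ⟨g, hg⟩) γ ?_)⟩
  exact ((Path.Homotopic.Quotient.cast_cast ..).trans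
    (Path.Homotopic.Quotient.cast_rfl_rfl _)).symm

theorem exists_isCoveringMap_monodromy_eq_of_chartedSpace (E : Type*) {P : Type uP} {A : Type uG}
    [NormedAddCommGroup E] [NormedSpace ℝ E] [TopologicalSpace P] [ChartedSpace E P]
    [PathConnectedSpace P] [Group A] {p₀ : P} (φ : FundamentalGroup P p₀ →* A) :
    ∃ (Q : Type max uP uG) (_ : TopologicalSpace Q) (u : Q → P) (cov : IsCoveringMap u)
      (mk : ∀ p, A ≃ u ⁻¹' {p}), ∀ (c : FundamentalGroup P p₀) (v : A),
        cov.monodromy c.toPath (mk p₀ v) = mk p₀ (φ c * v) := by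
  obtain ⟨Q, _, u, cov, mk, hmk⟩ := exists_isCoveringMap_monodromy_eq (f := .id P)
    Function.surjective_id φ fun p U hU => by
      obtain ⟨V, hVU, hVo, hpV, hV⟩ := exists_isSimplyConnected_nhds E p hU
      refine ⟨V, hVU, hVo, hpV, hV.isPathConnected, fun y δ γ hδ => ?_⟩
      have hδ_refl : Path.Homotopic.Quotient.mk δ = .refl y := Path.Homotopic.Quotient.eq.2
        (homotopic_of_isSimplyConnected hV hδ fun _ => δ.source ▸ hδ 0)
      rw [hδ_refl, Path.Homotopic.Quotient.refl_trans, Path.Homotopic.Quotient.trans_symm]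
      exact map_one φ
  refine ⟨Q, _, u, cov, mk, fun c v => ?_⟩
  obtain ⟨δ, rfl⟩ := Path.Homotopic.Quotient.mk_surjective c
  exact hmk (.fromPath (.mk δ)) v

namespace IsPrincipalBundle

variable {n k d : ℕ} {M : Type uM} [TopologicalSpace M] [ChartedSpace (EuclideanSpace ℝ (Fin n)) M]
  {G : Type uG} [Group G] [TopologicalSpace G] [ChartedSpace (EuclideanSpace ℝ (Fin k)) G]
  {P : Type uP} [TopologicalSpace P] [ChartedSpace (EuclideanSpace ℝ (Fin d)) P]
  [MulAction Gᵐᵒᵖ P] {πP : P → M} (hP : IsPrincipalBundle n k d G πP)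
include hP

theorem exists_isCoveringMap_bijective_monodromy [PathConnectedSpace P] {p₀ : P}
    {r : FundamentalGroup P p₀ →* FundamentalGroup G (1 : G)}
    (hr : Function.LeftInverse r (hP.orbitPi1 p₀)) :
    ∃ (Q : Type uP) (_ : TopologicalSpace Q) (u : Q → P) (cov : IsCoveringMap u),
      Function.Surjective u ∧ ∀ q : u ⁻¹' {p₀},
        Function.Bijective fun b => cov.monodromy (hP.orbitPi1 p₀ b).toPath q := by
  obtain ⟨Q, _, u, cov, mk, hmk⟩ := exists_isCoveringMap_monodromy_eq_of_chartedSpace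
    (EuclideanSpace ℝ (Fin d)) ((hP.orbitPi1 p₀).rangeRestrict.comp r)
  refine ⟨Q, _, u, cov, fun p => ⟨mk p 1, (mk p 1).2⟩, fun q => ?_⟩
  obtain ⟨v, rfl⟩ := (mk p₀).surjective q
  have hφ (b : FundamentalGroup G 1) :
      cov.monodromy (hP.orbitPi1 p₀ b).toPath (mk p₀ v) =
        mk p₀ ((hP.orbitPi1 p₀).rangeRestrict b * v) := by
    rw [hmk, MonoidHom.comp_apply, hr]
  simp only [hφ]
  exact (mk p₀).bijective.comp ((Group.mulRight_bijective v).comp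
    ⟨(MonoidHom.rangeRestrict_injective_iff).2 hr.injective,
      (hP.orbitPi1 p₀).rangeRestrict_surjective⟩)

variable {Q : Type*} [TopologicalSpace Q] {u : Q → P} (cov : IsCoveringMap u)

include cov in
theorem exists_mulAction_of_isCoveringMap {G' : Type*} [Group G'] [TopologicalSpace G']
    [ContinuousMul G'] [SimplyConnectedSpace G'] [LocallyPathConnectedSpace G'] {ρ : G' →* G}
    (hρ : Continuous ρ) :
    ∃ _ : MulAction G'ᵐᵒᵖ Q, (Continuous fun x : Q × G' => MulOpposite.op x.2 • x.1) ∧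
      ∀ (q : Q) (g : G'), u (MulOpposite.op g • q) = MulOpposite.op (ρ g) • u q := by
  have : SimplyConnectedSpace G'ᵐᵒᵖ :=
    MulOpposite.opHomeomorph.symm.toHomotopyEquiv.simplyConnectedSpace
  have : LocallyPathConnectedSpace G'ᵐᵒᵖ :=
    MulOpposite.opHomeomorph.isQuotientMap.locallyPathConnectedSpace
  let : MulAction G'ᵐᵒᵖ P := .compHom P ρ.op
  have : ContinuousSMul G'ᵐᵒᵖ P := ⟨hP.continuous_smul.comp (continuous_snd.prodMk
    (hρ.comp (MulOpposite.continuous_unop.comp continuous_fst)))⟩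
  obtain ⟨action, hcont, hequiv⟩ := exists_mulAction_lift (H := G'ᵐᵒᵖ) cov
  exact ⟨action, by fun_prop, fun q g => hequiv (.op g) q⟩

theorem bijective_monodromy_orbitPi1 [PathConnectedSpace P] {p₀ : P}
    (hp₀ : ∀ q : u ⁻¹' {p₀},
      Function.Bijective fun b => cov.monodromy (hP.orbitPi1 p₀ b).toPath q)
    {p : P} (q : u ⁻¹' {p}) :
    Function.Bijective fun b => cov.monodromy (hP.orbitPi1 p b).toPath q := by
  let γ : Path.Homotopic.Quotient p p₀ := .mk (PathConnectedSpace.somePath p p₀)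
  refine (Function.Bijective.of_comp_iff' (cov.monodromy_bijective γ) _).1 ?_
  convert hp₀ (cov.monodromy γ q) using 2 with b
  rw [Function.comp_apply, ← cov.monodromy_trans_apply, ← cov.monodromy_trans_apply,
    hP.trans_orbitPi1]

section EquivariantCovers

variable {G' : Type*} [Group G'] [TopologicalSpace G'] [MulAction G'ᵐᵒᵖ Q] {ρ : G' →* G}
  (hequiv : ∀ (q : Q) (g : G'), u (MulOpposite.op g • q) = MulOpposite.op (ρ g) • u q)
  (hρ : IsCoveringMap ρ) (hsmul : ∀ q : Q, Continuous fun g : G' => MulOpposite.op g • q)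
include hequiv hρ hsmul

theorem eq_one_of_injective_monodromy [PathConnectedSpace G']
    (hinj : ∀ (p : P) (q : u ⁻¹' {p}),
      Function.Injective fun b => cov.monodromy (hP.orbitPi1 p b).toPath q)
    {q : Q} {g : G'} (hg : MulOpposite.op g • q = q) : g = 1 := by
  have hρg : ρ g = 1 := hP.free (u q) _ (by rw [← hequiv, hg])
  obtain ⟨b, rfl⟩ := exists_monodromy_eq_of_map_eq_one hρ hρg
  have hfix : cov.monodromy (hP.orbitPi1 (u q) b).toPath ⟨q, rfl⟩ =
      cov.monodromy (hP.orbitPi1 (u q) 1).toPath ⟨q, rfl⟩ := by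
    refine Subtype.ext ((hP.monodromy_orbitPi1 hequiv hρ cov ⟨q, rfl⟩ (hsmul q) b).trans
      (hg.trans ?_))
    rw [map_one]
    exact congrArg Subtype.val (congrFun cov.monodromy_refl ⟨q, rfl⟩).symm
  obtain rfl : b = 1 := hinj _ _ hfix
  exact congrArg Subtype.val (congrFun hρ.monodromy_refl ⟨1, map_one ρ⟩)

theorem exists_smul_eq_of_surjective_monodromy (hρs : Function.Surjective ρ)
    (hsurj : ∀ (p : P) (q : u ⁻¹' {p}),
      Function.Surjective fun b => cov.monodromy (hP.orbitPi1 p b).toPath q)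
    {q q' : Q} (hq : πP (u q) = πP (u q')) : ∃ g : G', MulOpposite.op g • q = q' := by
  obtain ⟨g, hg⟩ := hP.transitive _ _ hq
  obtain ⟨g, rfl⟩ := hρs g
  rw [← hequiv] at hg
  obtain ⟨b, hb⟩ := hsurj (u q') ⟨MulOpposite.op g • q, hg⟩ ⟨q', rfl⟩
  refine ⟨g * hρ.monodromy b.toPath ⟨1, map_one ρ⟩, ?_⟩
  rw [MulOpposite.op_mul, mul_smul]
  exact (hP.monodromy_orbitPi1 hequiv hρ cov ⟨_, hg⟩ (hsmul _) b).symm.trans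
    (congrArg Subtype.val hb)

end EquivariantCovers

end IsPrincipalBundle

section Spinor

variable {n k d : ℕ} {M : Type uM} [TopologicalSpace M] [ChartedSpace (EuclideanSpace ℝ (Fin n)) M]
  [T2Space M] [ParacompactSpace M] [ConnectedSpace M]
  {G : Type uG} [Group G] [TopologicalSpace G] [ChartedSpace (EuclideanSpace ℝ (Fin k)) G]
  [IsTopologicalGroup G] [ConnectedSpace G]
  {G' : Type uGt} [Group G'] [TopologicalSpace G'] [ChartedSpace (EuclideanSpace ℝ (Fin k)) G']
  [IsTopologicalGroup G'] [T2Space G'] [ParacompactSpace G']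
  {ρ : G' →* G} (hρ : IsUniversalCoveringGroup k ρ)
  {P : Type uP} [TopologicalSpace P] [ChartedSpace (EuclideanSpace ℝ (Fin d)) P]
  [IsManifold (𝓡 d) ∞ P] [T2Space P] [MulAction Gᵐᵒᵖ P] {πP : P → M}
  (hP : IsPrincipalBundle n k d G πP)
include hρ hP

theorem IsPrincipalBundle.nonempty_spinorStructure {p₀ : P}
    {r : FundamentalGroup P p₀ →* FundamentalGroup G (1 : G)}
    (hr : Function.LeftInverse r (hP.orbitPi1 p₀)) :
    Nonempty (SpinorStructure n k d ρ πP) := by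
  have := hρ.simplyConnected
  have := hP.pathConnectedSpace
  have := ChartedSpace.locallyPathConnectedSpace (EuclideanSpace ℝ (Fin k)) G'
  obtain ⟨Q, _, u, cov, hsurj, hu₀⟩ := hP.exists_isCoveringMap_bijective_monodromy hr
  obtain ⟨_, hsmul, hequiv⟩ := hP.exists_mulAction_of_isCoveringMap cov hρ.isCoveringMap.continuous
  have hbij {p : P} (q : u ⁻¹' {p}) := hP.bijective_monodromy_orbitPi1 cov hu₀ q
  have hsmul_left (q : Q) : Continuous fun g : G' => MulOpposite.op g • q :=
    hsmul.comp (.prodMk_right q)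
  let := pullbackChartedSpace (H := EuclideanSpace ℝ (Fin d)) cov.isLocalHomeomorph
  have hu : IsLocalDiffeomorph (𝓡 d) (𝓡 d) ∞ u :=
    isLocalDiffeomorph_pullbackChartedSpace cov.isLocalHomeomorph
  have hQ : IsPrincipalBundle n k d G' (πP ∘ u) :=
    hP.comp_isLocalDiffeomorph hu hρ.isLocalDiffeomorph hsmul hequiv
      (fun _ _ => hP.eq_one_of_injective_monodromy cov hequiv hρ.isCoveringMap hsmul_left
        fun _ q => (hbij q).injective)
      (fun _ _ => hP.exists_smul_eq_of_surjective_monodromy cov hequiv hρ.isCoveringMap hsmul_left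
        hρ.surjective fun _ q => (hbij q).surjective)
      hsurj
  have : T2Space Q := t2Space_of_isSeparatedMap cov.isSeparatedMap cov.continuous
  have : LocallyCompactSpace Q := ChartedSpace.locallyCompactSpace (EuclideanSpace ℝ (Fin d)) Q
  have : SecondCountableTopology M :=
    secondCountableTopology_of_connectedSpace_of_paracompactSpace (H := EuclideanSpace ℝ (Fin n))
  have : SecondCountableTopology G' :=
    secondCountableTopology_of_connectedSpace_of_paracompactSpace (H := EuclideanSpace ℝ (Fin k))
  have : SecondCountableTopology Q := hQ.secondCountableTopology
  exact ⟨
    { Q := Q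
      dim := d
      isManifold := isManifold_pullbackChartedSpace cov.isLocalHomeomorph
      πQ := πP ∘ u
      isPrincipalBundle := hQ
      u := u
      smooth_u := hu.contMDiff
      proj_u := fun _ => rfl
      equivariant_u := hequiv }⟩

theorem nonempty_spinorStructure_iff_exists_leftInverse (p₀ : P) :
    Nonempty (SpinorStructure n k d ρ πP) ↔
      ∃ r : FundamentalGroup P p₀ →* FundamentalGroup G (1 : G),
        Function.LeftInverse r (hP.orbitPi1 p₀) :=
  ⟨fun ⟨S⟩ => S.exists_leftInverse_orbitPi1 hρ hP p₀,
    fun ⟨_, hr⟩ => hP.nonempty_spinorStructure hρ hr⟩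

end Spinor

theorem mainTheorem1 (n k d : ℕ)
    {M : Type uM} [TopologicalSpace M] [ChartedSpace (EuclideanSpace ℝ (Fin n)) M]
    [IsManifold (𝓡 n) ∞ M] [T2Space M] [ParacompactSpace M] [ConnectedSpace M]
    {G : Type uG} [Group G] [TopologicalSpace G] [ChartedSpace (EuclideanSpace ℝ (Fin k)) G]
    [LieGroup (𝓡 k) ∞ G] [T2Space G] [ParacompactSpace G] [ConnectedSpace G]
    (hG : ¬ SimplyConnectedSpace G)
    {G' : Type uGt} [Group G'] [TopologicalSpace G'] [ChartedSpace (EuclideanSpace ℝ (Fin k)) G']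
    [LieGroup (𝓡 k) ∞ G'] [T2Space G'] [ParacompactSpace G']
    (ρ : G' →* G) (hρ : IsUniversalCoveringGroup k ρ)
    {P : Type uP} [TopologicalSpace P] [ChartedSpace (EuclideanSpace ℝ (Fin d)) P]
    [IsManifold (𝓡 d) ∞ P] [T2Space P] [ParacompactSpace P] [MulAction Gᵐᵒᵖ P]
    (πP : P → M) (hP : IsPrincipalBundle n k d G πP) (p₀ : P) :
    Nonempty (SpinorStructure n k d ρ πP) ↔
      ∃ K I : Subgroup (FundamentalGroup P p₀),
        IsInternalDirectProduct K I ∧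
        Set.BijOn (hP.projPi1 p₀) (K : Set (FundamentalGroup P p₀)) Set.univ ∧
        Set.BijOn (hP.orbitPi1 p₀) Set.univ (I : Set (FundamentalGroup P p₀)) := by
  have : IsTopologicalGroup G := topologicalGroup_of_lieGroup (𝓡 k) ∞
  have : IsTopologicalGroup G' := topologicalGroup_of_lieGroup (𝓡 k) ∞
  rw [nonempty_spinorStructure_iff_exists_leftInverse hρ hP p₀]
  exact (exists_isInternalDirectProduct_iff (hP.orbitPi1_commute p₀) (hP.range_orbitPi1 p₀)
    (hP.surjective_projPi1 p₀)).symm
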